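/- Let $0\le r<s$ be integers such that $3\nmid 2r+s$ and let $b_1,\dots,b_{s+r}\in\mathbb C$ be pairwise distinct. Put $\hat r=2r+s$, $\hat s=2s+r$, $g=r+s-1$, $k_s(x)=\prod_{i=1}^{s}(x-b_i)$, $k_r(x)=\prod_{i=s+1}^{s+r}(x-b_i)$, and $$R=\mathbb C[x,y_{\hat r},y_{\hat s}]\big/\big(y_{\hat r}^2-y_{\hat s}k_r(x),\; y_{\hat r}y_{\hat s}-k_r(x)k_s(x),\; y_{\hat s}^2-y_{\hat r}k_s(x)\big).$$ Then $R$ is an integral domain; let $K$ be its field of fractions and $X$ the complete nonsingular curve over $\mathbb C$ with function field $K$, whose points are the discrete valuation rings $\mathbb C\subseteq\mathcal O\subset K$ with field of fractions $K$. For a set $U$ of points of $X$ let $H^0(U,\Omega_X)\subseteq\Omega_{K/\mathbb C}$ be the space of differentials of $K$ over $\mathbb C$ that are regular at every point of $U$. Let $\widehat R\subseteq R$ be the space of functions $f\in R$ that vanish at all the branch points $B_i=(b_i,0,0)$, $i=1,\dots,s+r$. Give $x,y_{\hat r},y_{\hat s}$ the weights $3,\hat r,\hat s$, and let $\hat\phi_0,\hat\phi_1,\hat\phi_2,\dots$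 be monomials in $x,y_{\hat r},y_{\hat s}$ divisible by $y_{\hat r}$ or $y_{\hat s}$, in strictly increasing order of weight, with exactly one monomial for each weight that is attained by a monomial divisible by $y_{\hat r}$ or $y_{\hat s}$ (for instance the monomials $x^ay_{\hat r}$, $x^ay_{\hat s}$, $x^ay_{\hat r}y_{\hat s}$, $a\ge 0$, ordered by weight). Then there is exactly one point $\infty$ of $X$ at which $x$ has a pole, and 1. $\{\hat\phi_i\}_{i\ge 0}$ is a basis of the $\mathbb C$-vector space $\widehat R$; 2. $\displaystyle\Big\{\frac{\hat\phi_i\,dx}{y_{\hat r}y_{\hat s}}\Big\}_{i\ge 0}$ is a basis of the $\mathbb C$-vector space $H^0(X\setminus\infty,\Omega_X)$; 3. $\displaystyle\Big\{\nu^I_i=\frac{\hat\phi_{i-1}\,dx}{3\,y_{\hat r}y_{\hat s}}\Big\}_{i=1,\dots,g}$ is a basis of the space $H^0(X,\Omega_X)$ of holomorphic differentials on $X$. -/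

import Mathlib

open scoped Polynomial

noncomputable section

section Places

variable (k K : Type*) [Field k] [Field K] [Algebra k K]

/-- A point of the complete nonsingular curve with function field `K` over `k`:
a discrete valuation ring `k ⊆ 𝒪 ⊆ K` with field of fractions `K`. -/
@[ext]
structure CurvePoint where
  ring : Subalgebra k K
  isDVR : IsDiscreteValuationRing ring
  isFractionRing : IsFractionRing ring K

variable {k K}

/-- The differentials of `K` over `k` that are regular at the point `P`: the image in
`Ω[K⁄k]` of the differentials of the local ring of `P`, i.e. the sums `∑ fᵢ dgᵢ` with
`fᵢ`, `gᵢ` in that ring. -/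
def CurvePoint.regularDifferentials (P : CurvePoint k K) : Submodule k (Ω[K⁄k]) :=
  (Submodule.span P.ring
    (Set.range fun f : P.ring => KaehlerDifferential.D k K (f : K))).restrictScalars k

/-- `H⁰(U, Ω)` for a set `U` of points of the curve. -/
def regularDifferentialsOn (U : Set (CurvePoint k K)) : Submodule k (Ω[K⁄k]) :=
  ⨅ P ∈ U, P.regularDifferentials

end Places

/-- The family `v` is a basis of the subspace `S`. -/
def IsBasisOf {k V ι : Type*} [Field k] [AddCommGroup V] [Module k V]
    (v : ι → V) (S : Submodule k V) : Prop :=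
  LinearIndependent k v ∧ Submodule.span k (Set.range v) = S

/-- The data of a cyclic trigonal curve with one point at infinity: `0 ≤ r < s`,
`2r + s` (equivalently `2s + r`) prime to `3`, and `s + r` distinct branch points. -/
structure TrigonalData where
  r : ℕ
  s : ℕ
  r_lt_s : r < s
  not_dvd : ¬ 3 ∣ 2 * r + s
  b : Fin (s + r) → ℂ
  b_injective : Function.Injective b

namespace TrigonalData

variable (C : TrigonalData)

/-- `r̂ = 2r + s`. -/
def rHat : ℕ := 2 * C.r + C.s

/-- `ŝ = 2s + r`. -/
def sHat : ℕ := 2 * C.s + C.r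

/-- `g = r + s - 1` (here `s ≥ 1`). -/
def g : ℕ := C.r + C.s - 1

/-- `k_s = (x - b₁) ⋯ (x - b_s)`. -/
def ks : ℂ[X] := ∏ i : Fin C.s, (Polynomial.X - Polynomial.C (C.b (Fin.castAdd C.r i)))

/-- `k_r = (x - b_{s+1}) ⋯ (x - b_{s+r})`. -/
def kr : ℂ[X] := ∏ i : Fin C.r, (Polynomial.X - Polynomial.C (C.b (Fin.natAdd C.s i)))

/-- The ideal of `ℂ[x, y_r̂, y_ŝ]` (variables `X 0, X 1, X 2`) generated by
`y_r̂² - y_ŝ k_r(x)`, `y_r̂ y_ŝ - k_r(x) k_s(x)`, `y_ŝ² - y_r̂ k_s(x)`. -/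
def relations : Ideal (MvPolynomial (Fin 3) ℂ) :=
  Ideal.span
    {MvPolynomial.X 1 ^ 2 - MvPolynomial.X 2 * Polynomial.aeval (MvPolynomial.X 0) C.kr,
     MvPolynomial.X 1 * MvPolynomial.X 2
      - Polynomial.aeval (MvPolynomial.X 0) C.kr * Polynomial.aeval (MvPolynomial.X 0) C.ks,
     MvPolynomial.X 2 ^ 2 - MvPolynomial.X 1 * Polynomial.aeval (MvPolynomial.X 0) C.ks}

/-- The affine coordinate ring `R` of `X ∖ ∞`. -/
abbrev R : Type := MvPolynomial (Fin 3) ℂ ⧸ C.relations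

/-- The function `x`. -/
def x : C.R := Ideal.Quotient.mk C.relations (MvPolynomial.X 0)

/-- The function `y_r̂`. -/
def yr : C.R := Ideal.Quotient.mk C.relations (MvPolynomial.X 1)

/-- The function `y_ŝ`. -/
def ys : C.R := Ideal.Quotient.mk C.relations (MvPolynomial.X 2)

theorem mk_aeval (q : ℂ[X]) :
    Ideal.Quotient.mk C.relations (Polynomial.aeval (MvPolynomial.X 0) q)
      = Polynomial.aeval C.x q := by
  have := Polynomial.aeval_algHom_apply (Ideal.Quotient.mkₐ ℂ C.relations)
    (MvPolynomial.X 0) q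
  exact this.symm

theorem yr_sq : C.yr ^ 2 = C.ys * Polynomial.aeval C.x C.kr := by
  rw [← mk_aeval]
  refine (Ideal.Quotient.eq.2 (Ideal.subset_span ?_))
  simp

theorem yr_mul_ys :
    C.yr * C.ys = Polynomial.aeval C.x C.kr * Polynomial.aeval C.x C.ks := by
  rw [← mk_aeval, ← mk_aeval]
  refine (Ideal.Quotient.eq.2 (Ideal.subset_span ?_))
  simp

theorem ys_sq : C.ys ^ 2 = C.yr * Polynomial.aeval C.x C.ks := by
  rw [← mk_aeval]
  refine (Ideal.Quotient.eq.2 (Ideal.subset_span ?_))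
  simp

theorem exists_normalForm (z : C.R) : ∃ p q t : ℂ[X],
    z = Polynomial.aeval C.x p + Polynomial.aeval C.x q * C.yr
      + Polynomial.aeval C.x t * C.ys := by
  obtain ⟨z, rfl⟩ := Ideal.Quotient.mk_surjective z
  induction z using MvPolynomial.induction_on with
  | C a =>
    refine ⟨Polynomial.C a, 0, 0, ?_⟩
    simp only [map_zero, zero_mul, add_zero, Polynomial.aeval_C]
    rfl
  | add u v hu hv =>
    obtain ⟨p, q, t, h⟩ := hu
    obtain ⟨p', q', t', h'⟩ := hv
    refine ⟨p + p', q + q', t + t', ?_⟩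
    rw [map_add, h, h']
    simp only [map_add]
    ring
  | mul_X u i hu =>
    obtain ⟨p, q, t, h⟩ := hu
    rw [map_mul, h]
    fin_cases i
    · refine ⟨p * Polynomial.X, q * Polynomial.X, t * Polynomial.X, ?_⟩
      change _ * C.x = _
      simp only [map_mul, Polynomial.aeval_X]
      ring
    · refine ⟨t * (C.kr * C.ks), p, q * C.kr, ?_⟩
      change _ * C.yr = _
      simp only [map_mul]
      linear_combination (Polynomial.aeval C.x q) * C.yr_sq
        + (Polynomial.aeval C.x t) * C.yr_mul_ys
    · refine ⟨q * (C.kr * C.ks), t * C.ks, p, ?_⟩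
      change _ * C.ys = _
      simp only [map_mul]
      linear_combination (Polynomial.aeval C.x t) * C.ys_sq
        + (Polynomial.aeval C.x q) * C.yr_mul_ys

theorem kr_monic : C.kr.Monic := Polynomial.monic_prod_X_sub_C _ _

theorem ks_monic : C.ks.Monic := Polynomial.monic_prod_X_sub_C _ _

/-- `y_r̂³ - k_r² k_s` over `ℂ(x)`. -/
def cubic : Polynomial (RatFunc ℂ) :=
  Polynomial.X ^ 3 - Polynomial.C (algebraMap ℂ[X] (RatFunc ℂ) (C.kr ^ 2 * C.ks))

theorem cubic_irreducible : Irreducible C.cubic := by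
  unfold cubic
  rw [X_pow_sub_C_irreducible_iff_of_prime Nat.prime_three]
  intro f hf
  have h0 : C.kr ^ 2 * C.ks ≠ 0 := ((C.kr_monic.pow 2).mul C.ks_monic).ne_zero
  have hd : (C.kr ^ 2 * C.ks).natDegree = 2 * C.r + C.s := by
    rw [(C.kr_monic.pow 2).natDegree_mul C.ks_monic, C.kr_monic.natDegree_pow]
    simp [kr, ks, Polynomial.natDegree_prod_of_monic, Polynomial.monic_X_sub_C]
  have hf0 : f ≠ 0 := by
    rintro rfl
    rw [zero_pow (by norm_num)] at hf
    exact h0 (RatFunc.algebraMap_injective ℂ (by rw [← hf, map_zero]))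
  have h := congrArg RatFunc.intDegree hf
  rw [RatFunc.intDegree_polynomial, hd] at h
  have h3 : (f ^ 3).intDegree = 3 * f.intDegree := by
    rw [pow_succ, pow_two, RatFunc.intDegree_mul (mul_ne_zero hf0 hf0) hf0,
      RatFunc.intDegree_mul hf0 hf0]
    ring
  rw [h3] at h
  apply C.not_dvd
  omega

theorem cubic_identities {F : Type*} [Field F] {y a b : F} (ha : a ≠ 0)
    (hy : y ^ 3 = a ^ 2 * b) :
    y ^ 2 - y ^ 2 / a * a = 0 ∧ y * (y ^ 2 / a) - a * b = 0 ∧ (y ^ 2 / a) ^ 2 - y * b = 0 := by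
  refine ⟨by field_simp; ring, ?_, ?_⟩
  · field_simp
    linear_combination hy
  · field_simp
    linear_combination y * hy

/-- `R` is an integral domain: it embeds into the field `ℂ(x)[y] / (y³ - k_r² k_s)`. -/
instance instIsDomain : IsDomain C.R := by
  have : Fact (Irreducible C.cubic) := ⟨C.cubic_irreducible⟩
  let L := AdjoinRoot C.cubic
  let ι : ℂ[X] →ₐ[ℂ] L := IsScalarTower.toAlgHom ℂ ℂ[X] L
  let y : L := AdjoinRoot.root C.cubic
  have hι : ∀ q, ι q = AdjoinRoot.of C.cubic (algebraMap ℂ[X] (RatFunc ℂ) q) := fun q => rfl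
  have hιinj : Function.Injective ι := by
    intro u v huv
    rw [hι, hι] at huv
    exact RatFunc.algebraMap_injective ℂ ((AdjoinRoot.of C.cubic).injective huv)
  have hkr : ι C.kr ≠ 0 := by
    intro h
    exact C.kr_monic.ne_zero (hιinj (by rw [h, map_zero]))
  have hy : y ^ 3 = ι C.kr ^ 2 * ι C.ks := by
    have := AdjoinRoot.eval₂_root C.cubic
    rw [cubic, Polynomial.eval₂_sub, Polynomial.eval₂_X_pow, Polynomial.eval₂_C,
      sub_eq_zero] at this
    rw [← map_pow, ← map_mul, hι]
    exact this
  let ψ₀ : MvPolynomial (Fin 3) ℂ →ₐ[ℂ] L :=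
    MvPolynomial.aeval ![ι Polynomial.X, y, y ^ 2 / ι C.kr]
  have hψ : ∀ q : ℂ[X], ψ₀ (Polynomial.aeval (MvPolynomial.X 0) q) = ι q := by
    intro q
    rw [← Polynomial.aeval_algHom_apply]
    have : ψ₀ (MvPolynomial.X 0) = ι Polynomial.X := by simp [ψ₀]
    rw [this, Polynomial.aeval_algHom_apply, Polynomial.aeval_X_left_apply]
  have h1 : ψ₀ (MvPolynomial.X 1) = y := by simp [ψ₀]
  have h2 : ψ₀ (MvPolynomial.X 2) = y ^ 2 / ι C.kr := by simp [ψ₀]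
  have hker : ∀ z ∈ C.relations, ψ₀ z = 0 := by
    intro z hz
    have : C.relations ≤ RingHom.ker ψ₀ := by
      rw [relations, Ideal.span_le]
      obtain ⟨e1, e2, e3⟩ := cubic_identities hkr hy
      rintro w (rfl | rfl | rfl)
      · simp only [SetLike.mem_coe, RingHom.mem_ker, map_sub, map_mul, map_pow, h1, h2, hψ]
        exact e1
      · simp only [SetLike.mem_coe, RingHom.mem_ker, map_sub, map_mul, h1, h2, hψ]
        exact e2
      · simp only [SetLike.mem_coe, RingHom.mem_ker, map_sub, map_mul, map_pow, h1, h2, hψ]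
        exact e3
    exact this hz
  let ψ : C.R →+* L := Ideal.Quotient.lift C.relations ψ₀.toRingHom hker
  have hinj : Function.Injective ψ := by
    rw [injective_iff_map_eq_zero]
    intro z hz
    obtain ⟨p, q, t, rfl⟩ := C.exists_normalForm z
    have hx : ∀ q : ℂ[X], ψ (Polynomial.aeval C.x q) = ι q := by
      intro q
      rw [← mk_aeval, ← hψ]
      rfl
    have hyr : ψ C.yr = y := h1
    have hys : ψ C.ys = y ^ 2 / ι C.kr := h2
    rw [map_add, map_add, map_mul, map_mul, hx, hx, hx, hyr, hys] at hz
    let a := algebraMap ℂ[X] (RatFunc ℂ)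
    have ha : ∀ q, ι q = AdjoinRoot.of C.cubic (a q) := hι
    have hakr : a C.kr ≠ 0 := by
      intro h
      exact hkr (by rw [ha, h, map_zero])
    let P : Polynomial (RatFunc ℂ) := Polynomial.C (a t / a C.kr) * Polynomial.X ^ 2
      + Polynomial.C (a q) * Polynomial.X + Polynomial.C (a p)
    have hP : AdjoinRoot.mk C.cubic P = 0 := by
      simp only [P, map_add, map_mul, map_pow, AdjoinRoot.mk_C, AdjoinRoot.mk_X, map_div₀]
      rw [← ha, ← ha, ← ha, ← ha, ← hz]
      simp only [y]
      ring
    rw [AdjoinRoot.mk_eq_zero] at hP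
    have hP0 : P = 0 := by
      refine Polynomial.eq_zero_of_dvd_of_natDegree_lt hP ?_
      have h3 : C.cubic.natDegree = 3 := Polynomial.natDegree_X_pow_sub_C
      rw [h3]
      exact lt_of_le_of_lt Polynomial.natDegree_quadratic_le (by norm_num)
    have c0 := congrArg (fun Q => Polynomial.coeff Q 0) hP0
    have c1 := congrArg (fun Q => Polynomial.coeff Q 1) hP0
    have c2 := congrArg (fun Q => Polynomial.coeff Q 2) hP0
    simp [P, Polynomial.coeff_X, Polynomial.coeff_C, hakr, a] at c0 c1 c2
    simp [c0, c1, c2]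
  exact hinj.isDomain ψ

/-- The function field of `X`. -/
abbrev K : Type := FractionRing C.R

/-- The space `R̂` of functions `f ∈ R` with `(f) - B₁ - ⋯ - B_{r+s} + ℓ ∞ ≥ 0` for some `ℓ`,
that is, of the regular functions on `X ∖ ∞` that vanish at all `Bᵢ = (bᵢ, 0, 0)`. -/
def RHat : Submodule ℂ C.R :=
  ⨅ i, (Ideal.span {C.x - algebraMap ℂ C.R (C.b i), C.yr, C.ys}).restrictScalars ℂ

/-- Exponents `(i, j, l)` of the monomial `x^i y_r̂^j y_ŝ^l`. -/
structure Exponent where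
  i : ℕ
  j : ℕ
  l : ℕ

/-- The weight, with `wt x = 3`, `wt y_r̂ = r̂`, `wt y_ŝ = ŝ`. -/
def wt (e : Exponent) : ℕ := 3 * e.i + C.rHat * e.j + C.sHat * e.l

/-- The monomial `x^i y_r̂^j y_ŝ^l` in `R`. -/
def monomial (e : Exponent) : C.R := C.x ^ e.i * C.yr ^ e.j * C.ys ^ e.l

/-- A sequence `φ̂₀, φ̂₁, …` of monomials divisible by `y_r̂` or `y_ŝ`, in increasing order of
weight, with one monomial for each weight of such a monomial. -/
structure PhiHat where
  exponent : ℕ → Exponent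
  divisible : ∀ n, 0 < (exponent n).j ∨ 0 < (exponent n).l
  wt_strictMono : StrictMono fun n => C.wt (exponent n)
  exhaustive : ∀ e : Exponent, 0 < e.j ∨ 0 < e.l → ∃ n, C.wt (exponent n) = C.wt e

/-- Such sequences exist. -/
instance instNonemptyPhiHat : Nonempty C.PhiHat := by
  classical
  let W : ℕ → Prop := fun w => ∃ e : Exponent, (0 < e.j ∨ 0 < e.l) ∧ C.wt e = w
  have hW : (Set.ofPred W).Infinite := by
    refine Set.infinite_of_injective_forall_mem (f := fun n : ℕ => C.wt ⟨n, 1, 0⟩) ?_ ?_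
    · intro m n h
      simp only [wt] at h
      omega
    · intro n
      exact ⟨⟨n, 1, 0⟩, Or.inl one_pos, rfl⟩
  have h : ∀ n, W (Nat.nth W n) := Nat.nth_mem_of_infinite hW
  choose e he hwt using h
  refine ⟨⟨e, he, ?_, ?_⟩⟩
  · intro m n hmn
    simp only [hwt]
    exact Nat.nth_strictMono hW hmn
  · intro d hd
    refine ⟨Nat.count W (C.wt d), ?_⟩
    rw [hwt]
    exact Nat.nth_count ⟨d, hd, rfl⟩

/-- The function `φ̂ₙ`. -/
def PhiHat.fn {C : TrigonalData} (φ : C.PhiHat) (n : ℕ) : C.R := C.monomial (φ.exponent n)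

/-- The differential `f dx / (y_r̂ y_ŝ)` of the function field, for `f ∈ R`. -/
def form (f : C.R) : Ω[C.K⁄ℂ] :=
  (algebraMap C.R C.K f / (algebraMap C.R C.K C.yr * algebraMap C.R C.K C.ys)) •
    KaehlerDifferential.D ℂ C.K (algebraMap C.R C.K C.x)

/-- The differential `f dx / (3 y_r̂ y_ŝ)`. -/
def formThird (f : C.R) : Ω[C.K⁄ℂ] :=
  (algebraMap C.R C.K f / (3 * algebraMap C.R C.K C.yr * algebraMap C.R C.K C.ys)) •
    KaehlerDifferential.D ℂ C.K (algebraMap C.R C.K C.x)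

end TrigonalData

end

/-!
The argument computes everything on the affine ring `R` and at one valuation.

*Away from infinity.* Since `k_r k_s` has simple roots, every local ring of `R` has a principal
maximal ideal (`isPrincipal_maximalIdeal_localization`), so each maximal ideal of `R` gives a point
of `X`, and every point where `x` is regular contains `R`. Let `ω₀ = dx / (y_r̂ y_ŝ)`. From
`y_r̂³ = k_r² k_s` and `y_ŝ³ = k_s² k_r` one gets `3 dy_r̂ = A y_r̂ ω₀` and `3 dy_ŝ = B y_ŝ ω₀` with
`A = 2 k_r' k_s + k_r k_s'` and `B = 2 k_s' k_r + k_s k_r'`, and `dx = y_r̂ y_ŝ ω₀`. As `A` and `B`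
are prime to `k_r k_s`, the `R`-module generated by the differentials of functions in `R` is
`R̂ ω₀`, where `R̂` is the ideal generated by `y_r̂` and `y_ŝ` (`exists_form_eq_D`,
`form_mem_regularDifferentials`). Comparing locally at all maximal ideals,
`H⁰(X ∖ ∞, Ω) = R̂ ω₀` (`exists_form_eq_of_regular`).

*At infinity.* Let `v` be a valuation that is trivial on `ℂ` and has a pole at `x`. Then
`v(y_r̂)³ = v(x)^r̂` and `v(y_ŝ)³ = v(x)^ŝ`, and as `0, r̂, ŝ` are distinct modulo `3`, the summands
of `p(x) + q(x) y_r̂ + t(x) y_ŝ` have distinct valuations. So `v(f)³ = v(x)^w` where `w` is the weight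
of the leading monomial of `f`. This shows that `v` is unique (`isEquiv_of_pole`) and discrete
(`isDiscreteValuationRing_of_pole`); a valuation ring dominating `ℂ[x⁻¹]` at `x⁻¹ = 0` provides
existence. Removing leading monomials one at a time shows that the `φ̂ᵢ` are a basis of `R̂`
(`linearIndependent_fn`, `mem_span_of_valuation_le`).

*Holomorphic differentials.* Derivations satisfy `v(df / dx) ≤ v(f) / v(x)` (`derivBound`), with
equality for a uniformizer `x ^ a / y_r̂` or `x ^ a / y_ŝ` (`exists_uniformizer`). Hence `f ω₀` is
regular at infinity if `f` has pole order less than `3 g`, and only if it has pole order at most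
`3 g`. No element of `R̂` has pole order exactly `3 g`, and exactly the first `g` of the `φ̂ᵢ` have
weight less than `3 g` (`wt_ne`, `wt_lt_iff`).
-/

noncomputable section

/-! ### Valuations with a pole at a given function -/

section LeadingTerms

open Polynomial in
/-- Among the summands `p i * y i`, where `x` has weight `3` and the weights `w i` of the `y i` are
distinct modulo `3`, exactly one has the largest weight. -/
theorem exists_dominant_summand {k ι : Type*} [Field k] [Fintype ι] {w : ι → ℕ}
    (hw : Function.Injective fun i => w i % 3) {p : ι → k[X]} (hp : p ≠ 0) :
    ∃ i, p i ≠ 0 ∧ ∀ j, j ≠ i → p j ≠ 0 →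
      3 * (p j).natDegree + w j < 3 * (p i).natDegree + w i := by
  classical
  obtain ⟨i₀, hi₀⟩ := Function.ne_iff.1 hp
  obtain ⟨i, hi, hmax⟩ := Finset.exists_max_image (Finset.univ.filter fun i => p i ≠ 0)
    (fun i => 3 * (p i).natDegree + w i) ⟨i₀, by simpa using hi₀⟩
  refine ⟨i, by simpa using hi, fun j hj hpj => lt_of_le_of_ne (hmax j (by simpa using hpj)) ?_⟩
  intro h
  refine hj (hw ?_)
  change w j % 3 = w i % 3
  omega

namespace Valuation

open Polynomial

variable {k K Γ₀ : Type*} [Field k] [Field K] [Algebra k K] [LinearOrderedCommGroupWithZero Γ₀]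
  (v : Valuation K Γ₀)

theorem pow_three_eq_iff {a b : K} : v a ^ 3 = v b ^ 3 ↔ v a = v b :=
  pow_left_inj₀ zero_le zero_le three_ne_zero

theorem pow_three_le_iff {a b : K} : v a ^ 3 ≤ v b ^ 3 ↔ v a ≤ v b :=
  pow_le_pow_iff_left₀ zero_le zero_le three_ne_zero

theorem pow_three_lt_iff {a b : K} : v a ^ 3 < v b ^ 3 ↔ v a < v b :=
  pow_lt_pow_iff_left₀ zero_le zero_le three_ne_zero

section Trivial

variable [v.IsTrivialOn k] {x : K}

theorem map_aeval_le (hx : 1 ≤ v x) {p : k[X]} {n : ℕ} (hp : p.natDegree ≤ n) :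
    v (aeval x p) ≤ v x ^ n := by
  rw [aeval_eq_sum_range]
  refine v.map_sum_le fun i hi => ?_
  rw [Algebra.smul_def, map_mul, map_pow]
  calc v (algebraMap k K (p.coeff i)) * v x ^ i ≤ 1 * v x ^ n := by
        refine mul_le_mul' (IsTrivialOn.valuation_algebraMap_le_one v _)
          (pow_le_pow_right₀ hx ?_)
        have := Finset.mem_range.1 hi
        omega
    _ = v x ^ n := one_mul _

theorem map_aeval_sub_leadingTerm_lt (hx : 1 < v x) (p : k[X]) :
    v (aeval x p - algebraMap k K p.leadingCoeff * x ^ p.natDegree) < v x ^ p.natDegree := by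
  have hx0 : 0 < v x := zero_lt_one.trans hx
  have h : aeval x p - algebraMap k K p.leadingCoeff * x ^ p.natDegree = aeval x p.eraseLead := by
    have := congrArg (aeval x) p.eraseLead_add_C_mul_X_pow
    rw [map_add, map_mul, aeval_C, map_pow, aeval_X] at this
    rw [← this, add_sub_cancel_right]
  rw [h]
  rcases p.eraseLead_natDegree_lt_or_eraseLead_eq_zero with h | h
  · exact (v.map_aeval_le hx.le le_rfl).trans_lt (pow_lt_pow_right₀ hx h)
  · rw [h, map_zero, map_zero]
    exact pow_pos hx0 _

theorem map_aeval_eq (hx : 1 < v x) {p : k[X]} (hp : p ≠ 0) :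
    v (aeval x p) = v x ^ p.natDegree := by
  have h1 : v (algebraMap k K p.leadingCoeff * x ^ p.natDegree) = v x ^ p.natDegree := by
    rw [map_mul, map_pow, IsTrivialOn.eq_one _ (leadingCoeff_ne_zero.2 hp), one_mul]
  rw [← h1]
  apply v.map_eq_of_sub_lt
  rw [h1]
  exact v.map_aeval_sub_leadingTerm_lt hx p

variable {ι : Type*} [Fintype ι] {w : ι → ℕ} {y : ι → K} {p : ι → k[X]} {i : ι}

/-- Subtracting the leading monomial of the dominant summand lowers the valuation. -/
theorem map_sum_sub_leadingTerm_lt (hx : 1 < v x) (hy : ∀ j, v (y j) ^ 3 = v x ^ w j)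
    (hdom : ∀ j, j ≠ i → p j ≠ 0 →
      3 * (p j).natDegree + w j < 3 * (p i).natDegree + w i) :
    v (∑ j, aeval x (p j) * y j
        - algebraMap k K (p i).leadingCoeff * (x ^ (p i).natDegree * y i))
      < v (x ^ (p i).natDegree * y i) := by
  classical
  have hx0 : v x ≠ 0 := (zero_lt_one.trans hx).ne'
  have hyi : 0 < v (y i) := by
    rw [zero_lt_iff]
    intro h
    have := hy i
    rw [h, zero_pow three_ne_zero] at this
    exact pow_ne_zero _ hx0 this.symm
  rw [← Finset.add_sum_erase _ _ (Finset.mem_univ i), ← mul_assoc, add_sub_right_comm, ← sub_mul]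
  apply v.map_add_lt
  · rw [map_mul, map_mul, map_pow]
    exact mul_lt_mul_of_pos_right (v.map_aeval_sub_leadingTerm_lt hx _) hyi
  · refine v.map_sum_lt' ?_ fun j hj => ?_
    · rw [map_mul, map_pow]
      exact mul_pos (pow_pos (zero_lt_iff.2 hx0) _) hyi
    · by_cases hpj : p j = 0
      · rw [hpj, map_zero, zero_mul, map_zero, map_mul, map_pow]
        exact mul_pos (pow_pos (zero_lt_iff.2 hx0) _) hyi
      · rw [← v.pow_three_lt_iff, map_mul, map_mul, mul_pow, mul_pow, hy, hy,
          v.map_aeval_eq hx hpj, map_pow, ← pow_mul, ← pow_mul, ← pow_add, ← pow_add]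
        apply pow_lt_pow_right₀ hx
        have := hdom j (Finset.ne_of_mem_erase hj) hpj
        omega

theorem map_sum_eq_map_leadingTerm (hx : 1 < v x) (hy : ∀ j, v (y j) ^ 3 = v x ^ w j)
    (hi : p i ≠ 0) (hdom : ∀ j, j ≠ i → p j ≠ 0 →
      3 * (p j).natDegree + w j < 3 * (p i).natDegree + w i) :
    v (∑ j, aeval x (p j) * y j) = v (x ^ (p i).natDegree * y i) := by
  have h1 : v (algebraMap k K (p i).leadingCoeff * (x ^ (p i).natDegree * y i))
      = v (x ^ (p i).natDegree * y i) := by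
    rw [map_mul, IsTrivialOn.eq_one _ (leadingCoeff_ne_zero.2 hi), one_mul]
  rw [← h1]
  apply v.map_eq_of_sub_lt
  rw [h1]
  exact v.map_sum_sub_leadingTerm_lt hx hy hdom

theorem map_sum_pow_three (hx : 1 < v x) (hy : ∀ j, v (y j) ^ 3 = v x ^ w j)
    (hi : p i ≠ 0) (hdom : ∀ j, j ≠ i → p j ≠ 0 →
      3 * (p j).natDegree + w j < 3 * (p i).natDegree + w i) :
    v (∑ j, aeval x (p j) * y j) ^ 3 = v x ^ (3 * (p i).natDegree + w i) := by
  rw [v.map_sum_eq_map_leadingTerm hx hy hi hdom, map_mul, mul_pow, hy, map_pow, ← pow_mul,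
    ← pow_add]
  congr 1
  omega

theorem map_summand_le (hw : Function.Injective fun i => w i % 3) (hx : 1 < v x)
    (hy : ∀ j, v (y j) ^ 3 = v x ^ w j) (p : ι → k[X]) (j : ι) :
    v (aeval x (p j) * y j) ≤ v (∑ j, aeval x (p j) * y j) := by
  by_cases hpj : p j = 0
  · simp [hpj]
  have hp : p ≠ 0 := fun h => hpj (by rw [h, Pi.zero_apply])
  obtain ⟨i, hi, hdom⟩ := exists_dominant_summand hw hp
  rw [← v.pow_three_le_iff, v.map_sum_pow_three hx hy hi hdom, map_mul, mul_pow, hy,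
    v.map_aeval_eq hx hpj, ← pow_mul, ← pow_add]
  apply pow_le_pow_right₀ hx.le
  by_cases hji : j = i
  · subst hji
    omega
  · have := hdom j hji hpj
    omega

/-- Two functions with the same pole order have proportional leading terms: at the places
considered here the residue field is the field of constants. -/
theorem exists_map_sub_lt (hw : Function.Injective fun i => w i % 3) (hx : 1 < v x)
    (hy : ∀ j, v (y j) ^ 3 = v x ^ w j) {f g : K}
    (hf : ∃ p : ι → k[X], f = ∑ j, aeval x (p j) * y j)
    (hg : ∃ p : ι → k[X], g = ∑ j, aeval x (p j) * y j) (hf0 : f ≠ 0) (hfg : v f = v g) :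
    ∃ c : k, v (f - algebraMap k K c * g) < v f := by
  obtain ⟨p, rfl⟩ := hf
  obtain ⟨q, rfl⟩ := hg
  have hp : p ≠ 0 := by
    rintro rfl
    simp at hf0
  have hq : q ≠ 0 := by
    rintro rfl
    rw [← v.ne_zero_iff, hfg] at hf0
    simp at hf0
  obtain ⟨i, hi, hdi⟩ := exists_dominant_summand hw hp
  obtain ⟨j, hj, hdj⟩ := exists_dominant_summand hw hq
  have hij := v.map_sum_pow_three hx hy hi hdi
  rw [hfg, v.map_sum_pow_three hx hy hj hdj] at hij
  have hij' := pow_right_injective₀ (zero_lt_one.trans hx) hx.ne' hij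
  obtain rfl : j = i := hw (by change w j % 3 = w i % 3; omega)
  have hdeg : (q j).natDegree = (p j).natDegree := by omega
  have h1 := v.map_sum_sub_leadingTerm_lt hx hy hdi
  have h2 := v.map_sum_sub_leadingTerm_lt hx hy hdj
  rw [v.map_sum_eq_map_leadingTerm hx hy hi hdi]
  rw [hdeg] at h2
  set m := x ^ (p j).natDegree * y j
  set a := (p j).leadingCoeff
  set b := (q j).leadingCoeff with hb
  have hb0 : algebraMap k K b ≠ 0 := by
    rw [Ne, map_eq_zero_iff _ (algebraMap k K).injective]
    exact leadingCoeff_ne_zero.2 hj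
  refine ⟨a / b, ?_⟩
  have : ∀ F G : K, F - algebraMap k K (a / b) * G
      = (F - algebraMap k K a * m) - algebraMap k K (a / b) * (G - algebraMap k K b * m) := by
    intro F G
    rw [map_div₀]
    field_simp
    ring
  rw [this]
  refine v.map_sub_lt h1 ?_
  rw [map_mul]
  exact (mul_le_of_le_one_left' (IsTrivialOn.valuation_algebraMap_le_one v _)).trans_lt h2

end Trivial

end Valuation

end LeadingTerms

namespace TrigonalData

variable (C : TrigonalData)

/-! ### The functions `x`, `y_r̂`, `y_ŝ` in the function field -/

/-- The function `x` in the function field. -/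
abbrev xK : C.K := algebraMap C.R C.K C.x

/-- The function `y_r̂` in the function field. -/
abbrev yrK : C.K := algebraMap C.R C.K C.yr

/-- The function `y_ŝ` in the function field. -/
abbrev ysK : C.K := algebraMap C.R C.K C.ys

theorem algebraMap_injective : Function.Injective (algebraMap C.R C.K) :=
  IsFractionRing.injective C.R C.K

theorem algebraMap_aeval (p : ℂ[X]) :
    algebraMap C.R C.K (Polynomial.aeval C.x p) = Polynomial.aeval C.xK p :=
  (Polynomial.aeval_algebraMap_apply C.K C.x p).symm

theorem yrK_sq : C.yrK ^ 2 = C.ysK * Polynomial.aeval C.xK C.kr := by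
  rw [← algebraMap_aeval, ← map_pow, ← map_mul, yr_sq]

theorem yrK_mul_ysK :
    C.yrK * C.ysK = Polynomial.aeval C.xK C.kr * Polynomial.aeval C.xK C.ks := by
  rw [← algebraMap_aeval, ← algebraMap_aeval, ← map_mul, ← map_mul, yr_mul_ys]

theorem ysK_sq : C.ysK ^ 2 = C.yrK * Polynomial.aeval C.xK C.ks := by
  rw [← algebraMap_aeval, ← map_pow, ← map_mul, ys_sq]

theorem natDegree_kr : C.kr.natDegree = C.r := by
  simp [kr, Polynomial.natDegree_prod_of_monic, Polynomial.monic_X_sub_C]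

theorem natDegree_ks : C.ks.natDegree = C.s := by
  simp [ks, Polynomial.natDegree_prod_of_monic, Polynomial.monic_X_sub_C]

theorem kr_mul_ks : C.kr * C.ks = ∏ i, (Polynomial.X - Polynomial.C (C.b i)) := by
  rw [Fin.prod_univ_add, kr, ks, mul_comm]

theorem kr_mul_ks_ne_zero : C.kr * C.ks ≠ 0 := (C.kr_monic.mul C.ks_monic).ne_zero

theorem separable_kr_mul_ks : (C.kr * C.ks).Separable := by
  rw [kr_mul_ks, Polynomial.separable_prod_X_sub_C_iff]
  exact C.b_injective

theorem rHat_mod_ne_zero : C.rHat % 3 ≠ 0 := fun h => C.not_dvd (Nat.dvd_of_mod_eq_zero h)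

/-! ### Points of the affine curve -/

variable {C} in
theorem exists_algHom_of_relations {a y z : ℂ} (h1 : y ^ 2 = z * C.kr.eval a)
    (h2 : y * z = C.kr.eval a * C.ks.eval a) (h3 : z ^ 2 = y * C.ks.eval a) :
    ∃ e : C.R →ₐ[ℂ] ℂ, e C.x = a ∧ e C.yr = y ∧ e C.ys = z := by
  let e₀ : MvPolynomial (Fin 3) ℂ →ₐ[ℂ] ℂ := MvPolynomial.aeval ![a, y, z]
  have hp : ∀ p : ℂ[X], e₀ (Polynomial.aeval (MvPolynomial.X 0) p) = p.eval a := by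
    intro p
    rw [← Polynomial.aeval_algHom_apply]
    simp [e₀, Polynomial.aeval_def, Polynomial.eval₂_eq_eval_map]
  have hle : C.relations ≤ RingHom.ker e₀ := by
    rw [relations, Ideal.span_le]
    rintro w (rfl | rfl | rfl)
    all_goals
      simp only [SetLike.mem_coe, RingHom.mem_ker, map_sub, map_mul, map_pow, hp]
      simp [e₀, h1, h2, h3]
  refine ⟨Ideal.Quotient.liftₐ C.relations e₀ fun w hw => hle hw, ?_, ?_, ?_⟩
  all_goals
    change e₀ _ = _
    simp [e₀]

theorem exists_algHom_branch (i : Fin (C.s + C.r)) :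
    ∃ e : C.R →ₐ[ℂ] ℂ, e C.x = C.b i ∧ e C.yr = 0 ∧ e C.ys = 0 := by
  apply exists_algHom_of_relations
  · simp
  · rw [← Polynomial.eval_mul, kr_mul_ks, Polynomial.eval_prod]
    rw [Finset.prod_eq_zero (Finset.mem_univ i) (by simp), zero_mul]
  · simp

variable {C} in
theorem algHom_aeval (e : C.R →ₐ[ℂ] ℂ) (p : ℂ[X]) :
    e (Polynomial.aeval C.x p) = p.eval (e C.x) := by
  rw [← Polynomial.aeval_algHom_apply, Polynomial.coe_aeval_eq_eval]

/-- The function `x` is transcendental: every value `a` that is not a root of `k_r` is attained. -/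
theorem aeval_x_eq_zero {p : ℂ[X]} (hp : Polynomial.aeval C.x p = 0) : p = 0 := by
  have h : p * C.kr = 0 := by
    refine Polynomial.funext fun a => ?_
    rw [Polynomial.eval_mul, Polynomial.eval_zero]
    by_cases ha : C.kr.eval a = 0
    · rw [ha, mul_zero]
    obtain ⟨y, hy⟩ := IsAlgClosed.exists_pow_nat_eq (C.kr.eval a ^ 2 * C.ks.eval a)
      (n := 3) (by norm_num)
    obtain ⟨e1, e2, e3⟩ := cubic_identities ha hy
    obtain ⟨e, hx, -, -⟩ := exists_algHom_of_relations (sub_eq_zero.1 e1) (sub_eq_zero.1 e2)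
      (sub_eq_zero.1 e3)
    have := algHom_aeval e p
    rw [hp, map_zero, hx] at this
    rw [← this, zero_mul]
  exact (mul_eq_zero.1 h).resolve_right C.kr_monic.ne_zero

theorem aeval_xK_ne_zero {p : ℂ[X]} (hp : p ≠ 0) : Polynomial.aeval C.xK p ≠ 0 := by
  rw [← algebraMap_aeval]
  intro h
  exact hp (C.aeval_x_eq_zero (C.algebraMap_injective (by rw [h, map_zero])))

theorem transcendental_xK : Transcendental ℂ C.xK :=
  transcendental_iff.2 fun _ h => by_contra fun h0 => C.aeval_xK_ne_zero h0 h

theorem xK_ne_zero : C.xK ≠ 0 := by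
  have := C.aeval_xK_ne_zero Polynomial.X_ne_zero
  rwa [Polynomial.aeval_X] at this

theorem yrK_mul_ysK_ne_zero : C.yrK * C.ysK ≠ 0 := by
  rw [yrK_mul_ysK, ← map_mul]
  exact C.aeval_xK_ne_zero C.kr_mul_ks_ne_zero

theorem yrK_ne_zero : C.yrK ≠ 0 := left_ne_zero_of_mul C.yrK_mul_ysK_ne_zero

theorem ysK_ne_zero : C.ysK ≠ 0 := right_ne_zero_of_mul C.yrK_mul_ysK_ne_zero

/-! ### Functions vanishing at the branch points -/

/-- A function vanishes at all branch points exactly if it lies in the ideal of `y_r̂`, `y_ŝ`,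
which over `ℂ[x]` is generated by `y_r̂ y_ŝ`, `y_r̂` and `y_ŝ`. -/
theorem mem_RHat_iff {f : C.R} : f ∈ C.RHat ↔ ∃ p q t : ℂ[X],
    f = Polynomial.aeval C.x p * (C.yr * C.ys) + Polynomial.aeval C.x q * C.yr
      + Polynomial.aeval C.x t * C.ys := by
  simp only [RHat, Submodule.mem_iInf, Submodule.restrictScalars_mem]
  constructor
  · intro hf
    obtain ⟨p, q, t, rfl⟩ := C.exists_normalForm f
    have hroot : ∀ i, p.eval (C.b i) = 0 := by
      intro i
      obtain ⟨e, hx, hy, hz⟩ := C.exists_algHom_branch i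
      have hle : Ideal.span {C.x - algebraMap ℂ C.R (C.b i), C.yr, C.ys} ≤ RingHom.ker e := by
        rw [Ideal.span_le]
        rintro w (rfl | rfl | rfl)
        · simp [hx]
        · simpa using hy
        · simpa using hz
      have := hle (hf i)
      rw [RingHom.mem_ker, map_add, map_add, map_mul, map_mul, hy, hz, algHom_aeval, hx] at this
      simpa using this
    have hdvd : C.kr * C.ks ∣ p := by
      rw [kr_mul_ks]
      refine Finset.prod_dvd_of_coprime ?_ fun i _ => Polynomial.dvd_iff_isRoot.2 (hroot i)
      exact fun i _ j _ hij => Polynomial.pairwise_coprime_X_sub_C C.b_injective hij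
    obtain ⟨u, rfl⟩ := hdvd
    refine ⟨u, q, t, ?_⟩
    rw [yr_mul_ys, map_mul, map_mul]
    ring
  · rintro ⟨p, q, t, rfl⟩ i
    have hy : C.yr ∈ Ideal.span {C.x - algebraMap ℂ C.R (C.b i), C.yr, C.ys} :=
      Ideal.subset_span (by simp)
    have hz : C.ys ∈ Ideal.span {C.x - algebraMap ℂ C.R (C.b i), C.yr, C.ys} :=
      Ideal.subset_span (by simp)
    exact add_mem (add_mem (Ideal.mul_mem_left _ _ (Ideal.mul_mem_left _ _ hz))
      (Ideal.mul_mem_left _ _ hy)) (Ideal.mul_mem_left _ _ hz)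

theorem yr_mem_RHat : C.yr ∈ C.RHat := C.mem_RHat_iff.2 ⟨0, 1, 0, by simp⟩

theorem ys_mem_RHat : C.ys ∈ C.RHat := C.mem_RHat_iff.2 ⟨0, 0, 1, by simp⟩

theorem mul_mem_RHat (u : C.R) {f : C.R} (hf : f ∈ C.RHat) : u * f ∈ C.RHat := by
  simp only [RHat, Submodule.mem_iInf, Submodule.restrictScalars_mem] at hf ⊢
  exact fun i => Ideal.mul_mem_left _ _ (hf i)

end TrigonalData

/-! ### Differentials of the function field -/

section Derivations

open Polynomial

/-- The logarithmic derivative of a cube root `y` of `p² q`, cleared of denominators. -/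
theorem Derivation.smul_cubeRoot {k K M : Type*} [Field k] [Field K] [Algebra k K]
    [AddCommGroup M] [Module k M] [Module K M] [IsScalarTower k K M] (d : Derivation k K M)
    {x y : K} {p q : k[X]} (hp : aeval x p ≠ 0) (hy0 : y ≠ 0)
    (hy : y ^ 3 = aeval x p ^ 2 * aeval x q) :
    (3 * (aeval x p * aeval x q)) • d y
      = (y * aeval x (2 * derivative p * q + p * derivative q)) • d x := by
  have h := congrArg d hy
  rw [← map_pow, ← map_mul, Derivation.map_aeval, Derivation.leibniz_pow] at h
  have h3 : (3 : ℕ) • y ^ (3 - 1) • d y = (3 * y ^ 2) • d y := by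
    rw [mul_smul, ← Nat.cast_smul_eq_nsmul K]
    norm_num
  rw [h3] at h
  have hd : aeval x (derivative (p ^ 2 * q))
      = aeval x p * aeval x (2 * derivative p * q + p * derivative q) := by
    rw [← map_mul]
    congr 1
    rw [derivative_mul, derivative_sq]
    simp only [map_ofNat]
    ring
  rw [hd] at h
  have h4 := congrArg (fun ω => (y / aeval x p) • ω) h
  simp only [smul_smul] at h4
  have e1 : y / aeval x p * (3 * y ^ 2) = 3 * (aeval x p * aeval x q) := by
    field_simp
    rw [hy]
    ring
  have e2 : y / aeval x p * (aeval x p * aeval x (2 * derivative p * q + p * derivative q))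
      = y * aeval x (2 * derivative p * q + p * derivative q) := by
    field_simp
  rw [e1, e2] at h4
  exact h4

end Derivations

section RegularDifferentials

variable {k K : Type*} [Field k] [Field K] [Algebra k K] (P : CurvePoint k K)

theorem CurvePoint.smul_mem_regularDifferentials {a : K} (ha : a ∈ P.ring) {ω : Ω[K⁄k]}
    (hω : ω ∈ P.regularDifferentials) : a • ω ∈ P.regularDifferentials :=
  Submodule.smul_mem (Submodule.span P.ring
    (Set.range fun f : P.ring => KaehlerDifferential.D k K (f : K))) (⟨a, ha⟩ : P.ring) hω

theorem CurvePoint.D_mem_regularDifferentials {a : K} (ha : a ∈ P.ring) :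
    KaehlerDifferential.D k K a ∈ P.regularDifferentials :=
  Submodule.subset_span ⟨⟨a, ha⟩, rfl⟩

/-- Regularity at `P` is checked on the differentials `df` and on sums and multiples. -/
theorem CurvePoint.regularDifferentials_induction {p : Ω[K⁄k] → Prop}
    (D : ∀ a ∈ P.ring, p (KaehlerDifferential.D k K a)) (zero : p 0)
    (add : ∀ ω η, p ω → p η → p (ω + η)) (smul : ∀ a ∈ P.ring, ∀ ω, p ω → p (a • ω))
    {ω : Ω[K⁄k]} (hω : ω ∈ P.regularDifferentials) : p ω := by
  refine Submodule.span_induction (p := fun ω _ => p ω) ?_ zero (fun ω η _ _ => add ω η)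
    (fun (a : P.ring) ω _ => smul a a.2 ω) hω
  rintro _ ⟨a, rfl⟩
  exact D a a.2

theorem mem_regularDifferentialsOn {U : Set (CurvePoint k K)} {ω : Ω[K⁄k]} :
    ω ∈ regularDifferentialsOn U ↔ ∀ P ∈ U, ω ∈ P.regularDifferentials := by
  simp [regularDifferentialsOn, Submodule.mem_iInf]

end RegularDifferentials

namespace TrigonalData

variable (C : TrigonalData)

open Polynomial KaehlerDifferential

/-- `2 k_r' k_s + k_r k_s'`, the numerator of `3 dy_r̂ / (y_r̂ dx)` over `k_r k_s`. -/
def logNumR : ℂ[X] := 2 * derivative C.kr * C.ks + C.kr * derivative C.ks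

/-- `2 k_s' k_r + k_s k_r'`, the numerator of `3 dy_ŝ / (y_ŝ dx)` over `k_r k_s`. -/
def logNumS : ℂ[X] := 2 * derivative C.ks * C.kr + C.ks * derivative C.kr

theorem yrK_pow_three : C.yrK ^ 3 = aeval C.xK C.kr ^ 2 * aeval C.xK C.ks := by
  linear_combination C.yrK * C.yrK_sq + aeval C.xK C.kr * C.yrK_mul_ysK

theorem ysK_pow_three : C.ysK ^ 3 = aeval C.xK C.ks ^ 2 * aeval C.xK C.kr := by
  linear_combination C.ysK * C.ysK_sq + aeval C.xK C.ks * C.yrK_mul_ysK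

theorem smul_D_yrK : (3 * (aeval C.xK C.kr * aeval C.xK C.ks)) • D ℂ C.K C.yrK
    = (C.yrK * aeval C.xK C.logNumR) • D ℂ C.K C.xK :=
  (D ℂ C.K).smul_cubeRoot (C.aeval_xK_ne_zero C.kr_monic.ne_zero) C.yrK_ne_zero C.yrK_pow_three

theorem smul_D_ysK : (3 * (aeval C.xK C.kr * aeval C.xK C.ks)) • D ℂ C.K C.ysK
    = (C.ysK * aeval C.xK C.logNumS) • D ℂ C.K C.xK := by
  rw [mul_comm (aeval C.xK C.kr)]
  exact (D ℂ C.K).smul_cubeRoot (C.aeval_xK_ne_zero C.ks_monic.ne_zero) C.ysK_ne_zero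
    C.ysK_pow_three

theorem form_add (f g : C.R) : C.form (f + g) = C.form f + C.form g := by
  rw [form, form, form, map_add, add_div, add_smul]

theorem form_mul (u f : C.R) : C.form (u * f) = algebraMap C.R C.K u • C.form f := by
  rw [form, form, smul_smul, map_mul, mul_div_assoc]

/-- `f ↦ f dx / (y_r̂ y_ŝ)` as a linear map. -/
def formLinearMap : C.R →ₗ[ℂ] Ω[C.K⁄ℂ] where
  toFun := C.form
  map_add' := C.form_add
  map_smul' c f := by
    have h : c • f = algebraMap ℂ C.R c * f := Algebra.smul_def c f
    rw [h, form_mul, ← IsScalarTower.algebraMap_apply ℂ C.R C.K, RingHom.id_apply,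
      algebraMap_smul]

theorem form_yr_mul_ys : C.form (C.yr * C.ys) = D ℂ C.K C.xK := by
  rw [form, map_mul, div_self C.yrK_mul_ysK_ne_zero, one_smul]

theorem form_logNumR : C.form (aeval C.x C.logNumR * C.yr) = (3 : C.K) • D ℂ C.K C.yrK := by
  have h0 := C.yrK_mul_ysK_ne_zero
  have h := congrArg (fun ω => (C.yrK * C.ysK)⁻¹ • ω) C.smul_D_yrK
  rw [← yrK_mul_ysK] at h
  simp only [smul_smul] at h
  rw [mul_left_comm, inv_mul_cancel₀ h0, mul_one] at h
  rw [h, form, map_mul, algebraMap_aeval, div_eq_inv_mul, mul_comm (aeval _ _)]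

theorem form_logNumS : C.form (aeval C.x C.logNumS * C.ys) = (3 : C.K) • D ℂ C.K C.ysK := by
  have h0 := C.yrK_mul_ysK_ne_zero
  have h := congrArg (fun ω => (C.yrK * C.ysK)⁻¹ • ω) C.smul_D_ysK
  rw [← yrK_mul_ysK] at h
  simp only [smul_smul] at h
  rw [mul_left_comm, inv_mul_cancel₀ h0, mul_one] at h
  rw [h, form, map_mul, algebraMap_aeval, div_eq_inv_mul, mul_comm (aeval _ _)]

theorem algebraMap_inv_three_mul : algebraMap ℂ C.K 3⁻¹ * 3 = 1 := by
  rw [← map_ofNat (algebraMap ℂ C.K) 3, ← map_mul, inv_mul_cancel₀ three_ne_zero, map_one]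

/-- The differential of a function in `R` is `f dx / (y_r̂ y_ŝ)` with `f` vanishing at the branch
points. -/
theorem exists_form_eq_D (u : C.R) : ∃ f ∈ C.RHat, D ℂ C.K (algebraMap C.R C.K u) = C.form f := by
  obtain ⟨p, q, t, rfl⟩ := C.exists_normalForm u
  have hyr : D ℂ C.K C.yrK = C.form (aeval C.x (Polynomial.C 3⁻¹ * C.logNumR) * C.yr) := by
    rw [map_mul, mul_assoc, form_mul, form_logNumR, smul_smul, aeval_C,
      ← IsScalarTower.algebraMap_apply ℂ C.R C.K, algebraMap_inv_three_mul, one_smul]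
  have hys : D ℂ C.K C.ysK = C.form (aeval C.x (Polynomial.C 3⁻¹ * C.logNumS) * C.ys) := by
    rw [map_mul, mul_assoc, form_mul, form_logNumS, smul_smul, aeval_C,
      ← IsScalarTower.algebraMap_apply ℂ C.R C.K, algebraMap_inv_three_mul, one_smul]
  have hx : ∀ p : ℂ[X], D ℂ C.K (algebraMap C.R C.K (aeval C.x p))
      = C.form (aeval C.x (derivative p) * (C.yr * C.ys)) := by
    intro p
    rw [form_mul, form_yr_mul_ys, algebraMap_aeval, Derivation.map_aeval, algebraMap_aeval]
  refine ⟨aeval C.x (derivative p) * (C.yr * C.ys)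
    + (aeval C.x q * (aeval C.x (Polynomial.C 3⁻¹ * C.logNumR) * C.yr)
      + C.yr * (aeval C.x (derivative q) * (C.yr * C.ys)))
    + (aeval C.x t * (aeval C.x (Polynomial.C 3⁻¹ * C.logNumS) * C.ys)
      + C.ys * (aeval C.x (derivative t) * (C.yr * C.ys))), ?_, ?_⟩
  · have hz := C.ys_mem_RHat
    have hy := C.yr_mem_RHat
    repeat' first | exact hz | exact hy | apply add_mem | apply C.mul_mem_RHat
  · simp only [map_add, map_mul (algebraMap C.R C.K), Derivation.leibniz, hx]
    rw [hyr, hys, form_add, form_add, form_add, form_add, C.form_mul (aeval C.x q),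
      C.form_mul C.yr, C.form_mul (aeval C.x t), C.form_mul C.ys]

theorem isCoprime_derivative : IsCoprime C.kr C.ks ∧ IsCoprime C.kr (derivative C.kr) ∧
    IsCoprime C.ks (derivative C.ks) :=
  ⟨C.separable_kr_mul_ks.isCoprime, C.separable_kr_mul_ks.of_mul_left,
    C.separable_kr_mul_ks.of_mul_right⟩

theorem isCoprime_two (p : ℂ[X]) : IsCoprime p 2 := by
  refine ⟨0, Polynomial.C 2⁻¹, ?_⟩
  rw [zero_mul, zero_add, ← map_ofNat Polynomial.C 2, ← map_mul, inv_mul_cancel₀ two_ne_zero,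
    map_one]

theorem isCoprime_logNumR : IsCoprime (C.kr * C.ks) C.logNumR := by
  obtain ⟨h, hr, hs⟩ := C.isCoprime_derivative
  refine IsCoprime.mul_left ?_ ?_
  · exact (((isCoprime_two _).mul_right hr).mul_right h).add_mul_left_right _
  · rw [logNumR, mul_comm _ C.ks]
    exact (h.symm.mul_right hs).mul_add_left_right _

theorem isCoprime_logNumS : IsCoprime (C.kr * C.ks) C.logNumS := by
  obtain ⟨h, hr, hs⟩ := C.isCoprime_derivative
  refine IsCoprime.mul_left ?_ ?_
  · rw [logNumS, mul_comm _ C.kr]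
    exact (h.mul_right hr).mul_add_left_right _
  · exact (((isCoprime_two _).mul_right hs).mul_right h.symm).add_mul_left_right _

/-- If `f` vanishes at the branch points, then `f dx / (y_r̂ y_ŝ)` is regular wherever all functions
in `R` are: `dx / y_ŝ` and `dx / y_r̂` are combinations of `dx`, `dy_r̂`, `dy_ŝ` over `R`, since the
numerators of the logarithmic derivatives of `y_r̂`, `y_ŝ` are prime to `k_r k_s`. -/
theorem form_mem_regularDifferentials {P : CurvePoint ℂ C.K}
    (hP : ∀ u : C.R, algebraMap C.R C.K u ∈ P.ring) {f : C.R} (hf : f ∈ C.RHat) :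
    C.form f ∈ P.regularDifferentials := by
  have hD : ∀ u : C.R, D ℂ C.K (algebraMap C.R C.K u) ∈ P.regularDifferentials :=
    fun u => P.D_mem_regularDifferentials (hP u)
  have hsmul : ∀ (u : C.R) {ω : Ω[C.K⁄ℂ]}, ω ∈ P.regularDifferentials →
      algebraMap C.R C.K u • ω ∈ P.regularDifferentials :=
    fun u ω => P.smul_mem_regularDifferentials (hP u)
  have h3 : (3 : C.K) = algebraMap C.R C.K 3 := (map_ofNat (algebraMap C.R C.K) 3).symm
  have hxx : C.form (C.yr * C.ys) ∈ P.regularDifferentials := by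
    rw [form_yr_mul_ys]
    exact hD _
  have key : ∀ (y : C.R) (A : ℂ[X]), IsCoprime (C.kr * C.ks) A →
      C.form (aeval C.x A * y) ∈ P.regularDifferentials → C.form y ∈ P.regularDifferentials := by
    -- multiply a Bézout relation for `k_r k_s = y_r̂ y_ŝ` and `A` by `y`
    rintro y A ⟨U, V, hUV⟩ hA
    have hy : y = aeval C.x V * (aeval C.x A * y) + aeval C.x U * (y * (C.yr * C.ys)) := by
      have := congrArg (aeval C.x) hUV
      simp only [map_add, map_mul, map_one] at this
      rw [yr_mul_ys]
      linear_combination (-y) * this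
    rw [hy, form_add, C.form_mul (aeval C.x V), C.form_mul (aeval C.x U), C.form_mul y]
    exact add_mem (hsmul _ hA) (hsmul _ (hsmul _ hxx))
  obtain ⟨p, q, t, rfl⟩ := C.mem_RHat_iff.1 hf
  rw [form_add, form_add, C.form_mul (aeval C.x p), C.form_mul (aeval C.x q),
    C.form_mul (aeval C.x t)]
  refine add_mem (add_mem (hsmul _ hxx) (hsmul _ ?_)) (hsmul _ ?_)
  · refine key _ _ C.isCoprime_logNumR ?_
    rw [form_logNumR, h3]
    exact hsmul _ (hD _)
  · refine key _ _ C.isCoprime_logNumS ?_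
    rw [form_logNumS, h3]
    exact hsmul _ (hD _)

/-- `Ω_K` is generated by `dx`. -/
theorem exists_eq_smul_D (ω : Ω[C.K⁄ℂ]) : ∃ h : C.K, ω = h • D ℂ C.K C.xK := by
  suffices h : Submodule.span C.K (Set.range (D ℂ C.K)) ≤ Submodule.span C.K {D ℂ C.K C.xK} by
    obtain ⟨h, rfl⟩ := Submodule.mem_span_singleton.1
      (h (span_range_derivation ℂ C.K ▸ Submodule.mem_top : ω ∈ _))
    exact ⟨h, rfl⟩
  have hR : ∀ u : C.R, D ℂ C.K (algebraMap C.R C.K u) ∈ Submodule.span C.K {D ℂ C.K C.xK} := by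
    intro u
    obtain ⟨f, -, hf⟩ := C.exists_form_eq_D u
    rw [hf, form]
    exact Submodule.smul_mem _ _ (Submodule.mem_span_singleton_self _)
  rw [Submodule.span_le]
  rintro _ ⟨a, rfl⟩
  obtain ⟨u, s, -, rfl⟩ := IsFractionRing.div_surjective C.R a
  rw [Derivation.leibniz_div]
  exact Submodule.smul_mem _ _
    (sub_mem (Submodule.smul_mem _ _ (hR u)) (Submodule.smul_mem _ _ (hR s)))

/-- Otherwise `K` would be unramified, hence algebraic, over `ℂ`. -/
theorem D_xK_ne_zero : D ℂ C.K C.xK ≠ 0 := by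
  intro h0
  have hsub : Subsingleton Ω[C.K⁄ℂ] := by
    refine (subsingleton_iff_forall_eq 0).2 fun ω => ?_
    obtain ⟨h, rfl⟩ := C.exists_eq_smul_D ω
    rw [h0, smul_zero]
  have : Algebra.FormallyUnramified ℂ C.K := ⟨hsub⟩
  have hsep : Algebra.IsSeparable ℂ C.K := Algebra.FormallyUnramified.isSeparable ℂ C.K
  exact C.transcendental_xK (hsep.isAlgebraic.isAlgebraic C.xK)

end TrigonalData

namespace TrigonalData

variable (C : TrigonalData)

open Polynomial KaehlerDifferential

/-! ### Points of the smooth affine curve -/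

variable {C} in
/-- Every maximal ideal of `R` is the ideal of functions vanishing at a complex point. -/
theorem exists_algHom_ker_eq (m : Ideal C.R) [hm : m.IsMaximal] :
    ∃ e : C.R →ₐ[ℂ] ℂ, ∀ u, u ∈ m ↔ e u = 0 := by
  let := Ideal.Quotient.field m
  have : Algebra.FiniteType ℂ (C.R ⧸ m) :=
    Algebra.FiniteType.of_surjective (Ideal.Quotient.mkₐ ℂ m) (Ideal.Quotient.mkₐ_surjective ℂ m)
  have : Module.Finite ℂ (C.R ⧸ m) := finite_of_finite_type_of_isJacobsonRing ℂ (C.R ⧸ m)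
  let E : ℂ ≃ₐ[ℂ] (C.R ⧸ m) := AlgEquiv.ofBijective (Algebra.ofId ℂ (C.R ⧸ m))
    (IsAlgClosed.algebraMap_bijective_of_isIntegral (k := ℂ) (K := C.R ⧸ m))
  refine ⟨E.symm.toAlgHom.comp (Ideal.Quotient.mkₐ ℂ m), fun u => ?_⟩
  rw [← Ideal.Quotient.eq_zero_iff_mem]
  exact (map_eq_zero_iff E.symm E.symm.injective).symm

variable {C} in
theorem exists_aeval_sub_eq (e : C.R →ₐ[ℂ] ℂ) (p : ℂ[X]) : ∃ q : ℂ[X],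
    aeval C.x p - algebraMap ℂ C.R (p.eval (e C.x))
      = (C.x - algebraMap ℂ C.R (e C.x)) * aeval C.x q := by
  obtain ⟨q, hq⟩ := X_sub_C_dvd_sub_C_eval (a := e C.x) (p := p)
  refine ⟨q, ?_⟩
  have := congrArg (aeval C.x) hq
  simpa only [map_sub, map_mul, aeval_X, aeval_C] using this

variable {C} in
theorem mem_span_of_algHom_eq_zero (e : C.R →ₐ[ℂ] ℂ) {u : C.R} (hu : e u = 0) :
    u ∈ Ideal.span {C.x - algebraMap ℂ C.R (e C.x), C.yr - algebraMap ℂ C.R (e C.yr),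
      C.ys - algebraMap ℂ C.R (e C.ys)} := by
  set J := Ideal.span {C.x - algebraMap ℂ C.R (e C.x), C.yr - algebraMap ℂ C.R (e C.yr),
      C.ys - algebraMap ℂ C.R (e C.ys)}
  have hx : C.x - algebraMap ℂ C.R (e C.x) ∈ J := Ideal.subset_span (by simp)
  have hy : C.yr - algebraMap ℂ C.R (e C.yr) ∈ J := Ideal.subset_span (by simp)
  have hz : C.ys - algebraMap ℂ C.R (e C.ys) ∈ J := Ideal.subset_span (by simp)
  have hp : ∀ p : ℂ[X], aeval C.x p - algebraMap ℂ C.R (p.eval (e C.x)) ∈ J := by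
    intro p
    obtain ⟨q, hq⟩ := exists_aeval_sub_eq e p
    rw [hq]
    exact J.mul_mem_right _ hx
  have hmul : ∀ {v w v' w' : C.R}, v - v' ∈ J → w - w' ∈ J → v * w - v' * w' ∈ J :=
    fun h1 h2 => J.mul_sub_mul_mem h1 h2
  obtain ⟨p, q, t, rfl⟩ := C.exists_normalForm u
  have h := add_mem (add_mem (hp p) (hmul (hp q) hy)) (hmul (hp t) hz)
  rw [map_add, map_add, map_mul, map_mul, algHom_aeval, algHom_aeval, algHom_aeval] at hu
  convert h using 1
  have := congrArg (algebraMap ℂ C.R) hu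
  simp only [map_add, map_mul, map_zero] at this
  linear_combination this

/-- The affine curve is smooth: each of its local rings has a principal maximal ideal, generated by
`x - a` away from the branch points, by `y_r̂` at the roots of `k_s` and by `y_ŝ` at those of
`k_r`. -/
theorem isPrincipal_maximalIdeal_localization (m : Ideal C.R) [hm : m.IsMaximal] (L : Type*)
    [CommRing L] [Algebra C.R L] [IsLocalization.AtPrime L m] [IsLocalRing L] :
    (IsLocalRing.maximalIdeal L).IsPrincipal := by
  obtain ⟨e, he⟩ := exists_algHom_ker_eq m
  set φ := algebraMap C.R L
  set a := e C.x with ha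
  set b := e C.yr with hb
  set c := e C.ys with hc
  have hunit : ∀ {u : C.R}, e u ≠ 0 → IsUnit (φ u) := fun {u} hu =>
    IsLocalization.map_units L (⟨u, fun h => hu ((he u).1 h)⟩ : m.primeCompl)
  have hmax : IsLocalRing.maximalIdeal L = (Ideal.span {C.x - algebraMap ℂ C.R a,
      C.yr - algebraMap ℂ C.R b, C.ys - algebraMap ℂ C.R c}).map φ := by
    rw [← IsLocalization.AtPrime.map_eq_maximalIdeal m L]
    congr 1
    refine le_antisymm (fun u hu => mem_span_of_algHom_eq_zero e ((he u).1 hu)) ?_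
    rw [Ideal.span_le]
    rintro w (rfl | rfl | rfl) <;> simp [he, ha, hb, hc]
  suffices h : ∃ t : C.R, e t = 0 ∧ φ t ∣ φ (C.x - algebraMap ℂ C.R a) ∧
      φ t ∣ φ (C.yr - algebraMap ℂ C.R b) ∧ φ t ∣ φ (C.ys - algebraMap ℂ C.R c) by
    obtain ⟨t, ht, h1, h2, h3⟩ := h
    refine ⟨φ t, le_antisymm ?_ ?_⟩
    · rw [hmax, Ideal.map_le_iff_le_comap, Ideal.span_le]
      rintro w (rfl | rfl | rfl)
      · exact Ideal.mem_span_singleton.2 h1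
      · exact Ideal.mem_span_singleton.2 h2
      · exact Ideal.mem_span_singleton.2 h3
    · change Ideal.span {φ t} ≤ _
      rw [Ideal.span_singleton_le_iff_mem, ← IsLocalization.AtPrime.map_eq_maximalIdeal m L]
      exact Ideal.mem_map_of_mem _ ((he t).2 ht)
  have hdvd : ∀ p : ℂ[X], φ (C.x - algebraMap ℂ C.R a) ∣
      φ (aeval C.x p - algebraMap ℂ C.R (p.eval a)) := by
    intro p
    obtain ⟨q, hq⟩ := exists_aeval_sub_eq e p
    rw [hq, map_mul]
    exact dvd_mul_right _ _
  have e1 : b ^ 2 = c * C.kr.eval a := by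
    have := congrArg e C.yr_sq
    rwa [map_pow, map_mul, algHom_aeval] at this
  have e2 : b * c = C.kr.eval a * C.ks.eval a := by
    have := congrArg e C.yr_mul_ys
    rwa [map_mul, map_mul, algHom_aeval, algHom_aeval] at this
  have e3 : c ^ 2 = b * C.ks.eval a := by
    have := congrArg e C.ys_sq
    rwa [map_pow, map_mul, algHom_aeval] at this
  -- branch points are the points where `y_r̂ y_ŝ` vanishes
  by_cases hbc : b * c = 0
  · have hb0 : b = 0 := by
      rcases mul_eq_zero.1 hbc with h | h
      · exact h
      · rw [h, zero_mul] at e1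
        exact pow_eq_zero_iff two_ne_zero |>.1 e1
    have hc0 : c = 0 := by
      rw [hb0, zero_mul] at e3
      exact pow_eq_zero_iff two_ne_zero |>.1 e3
    have hroot : (C.kr * C.ks).eval a = 0 := by rw [eval_mul, ← e2, hbc]
    obtain ⟨h, hh⟩ := dvd_iff_isRoot.2 hroot
    -- the root `a` of `k_r k_s` is simple
    have hha : h.eval a ≠ 0 := by
      have := C.separable_kr_mul_ks.aeval_derivative_ne_zero (x := a)
        (by rwa [coe_aeval_eq_eval])
      rw [coe_aeval_eq_eval, hh, derivative_mul] at this
      simpa using this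
    have hxa : φ (C.x - algebraMap ℂ C.R a) * φ (aeval C.x h) = φ C.yr * φ C.ys := by
      rw [← map_mul, ← map_mul, yr_mul_ys, ← map_mul, hh]
      simp
    have hhu : IsUnit (φ (aeval C.x h)) := hunit (by rwa [algHom_aeval])
    rw [hb0, hc0, map_zero, sub_zero, sub_zero]
    rcases mul_eq_zero.1 (eval_mul (R := ℂ) ▸ hroot) with hr | hs
    · have hs : C.ks.eval a ≠ 0 := by
        intro hs
        obtain ⟨U, V, hUV⟩ := C.isCoprime_derivative.1
        have := congrArg (eval a) hUV
        simp [hr, hs] at this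
      refine ⟨C.ys, hc0, ?_, ?_, dvd_rfl⟩
      · rw [← hhu.dvd_mul_right, hxa]
        exact dvd_mul_left _ _
      · have hu : IsUnit (φ (aeval C.x C.ks)) := hunit (by rwa [algHom_aeval])
        rw [← hu.dvd_mul_right, ← map_mul, ← ys_sq, map_pow]
        exact dvd_pow_self _ two_ne_zero
    · have hr : C.kr.eval a ≠ 0 := by
        intro hr
        obtain ⟨U, V, hUV⟩ := C.isCoprime_derivative.1
        have := congrArg (eval a) hUV
        simp [hr, hs] at this
      refine ⟨C.yr, hb0, ?_, dvd_rfl, ?_⟩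
      · rw [← hhu.dvd_mul_right, hxa]
        exact dvd_mul_right _ _
      · have hu : IsUnit (φ (aeval C.x C.kr)) := hunit (by rwa [algHom_aeval])
        rw [← hu.dvd_mul_right, ← map_mul, ← yr_sq, map_pow]
        exact dvd_pow_self _ two_ne_zero
  -- elsewhere `y_r̂³ - b³` is divisible by `x - a`, and its cofactor over `y_r̂ - b` is a unit
  · have hb0 : b ≠ 0 := left_ne_zero_of_mul hbc
    have hyr : φ (C.x - algebraMap ℂ C.R a) ∣ φ (C.yr - algebraMap ℂ C.R b) := by
      have hu : IsUnit (φ (C.yr ^ 2 + algebraMap ℂ C.R b * C.yr + algebraMap ℂ C.R b ^ 2)) := by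
        apply hunit
        simp only [map_add, map_mul, map_pow, AlgHom.commutes, Algebra.algebraMap_self_apply]
        rw [← hb]
        have : b ^ 2 + b * b + b ^ 2 = 3 * b ^ 2 := by ring
        rw [this]
        exact mul_ne_zero three_ne_zero (pow_ne_zero 2 hb0)
      rw [← hu.dvd_mul_right, ← map_mul]
      convert hdvd (C.kr ^ 2 * C.ks) using 2
      have h1 : C.yr ^ 3 = aeval C.x (C.kr ^ 2 * C.ks) := by
        rw [map_mul, map_pow]
        linear_combination C.yr * C.yr_sq + aeval C.x C.kr * C.yr_mul_ys
      have h2 : b ^ 3 = (C.kr ^ 2 * C.ks).eval a := by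
        rw [eval_mul, eval_pow]
        linear_combination b * e1 + C.kr.eval a * e2
      rw [← h1, ← h2, map_pow]
      ring
    refine ⟨C.x - algebraMap ℂ C.R a, by simp [ha], dvd_rfl, hyr, ?_⟩
    have hu : IsUnit (φ C.yr) := hunit hb0
    rw [← hu.dvd_mul_right, ← map_mul]
    have h1 : (C.ys - algebraMap ℂ C.R c) * C.yr
        = (aeval C.x (C.kr * C.ks) - algebraMap ℂ C.R ((C.kr * C.ks).eval a))
          - algebraMap ℂ C.R c * (C.yr - algebraMap ℂ C.R b) := by
      rw [map_mul, eval_mul, ← e2, ← yr_mul_ys, map_mul]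
      ring
    have h2 := dvd_sub (hdvd (C.kr * C.ks)) (hyr.mul_left (φ (algebraMap ℂ C.R c)))
    rwa [← map_mul, ← map_sub, ← h1] at h2

/-- The point of the curve given by the local ring of `R` at a maximal ideal. -/
def affinePoint (m : Ideal C.R) [hm : m.IsMaximal] : CurvePoint ℂ C.K where
  ring := (Localization.subalgebra.ofField C.K m.primeCompl
    m.primeCompl_le_nonZeroDivisors).restrictScalars ℂ
  isDVR := by
    set L := Localization.subalgebra.ofField C.K m.primeCompl m.primeCompl_le_nonZeroDivisors
    change IsDiscreteValuationRing L
    have hloc : IsLocalization.AtPrime L m :=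
      Localization.subalgebra.isLocalization_ofField C.K m.primeCompl _
    have : IsLocalRing L := IsLocalization.AtPrime.isLocalRing L m
    have : IsNoetherianRing L := IsLocalization.isNoetherianRing m.primeCompl L inferInstance
    have hm0 : m ≠ ⊥ := by
      rintro rfl
      obtain ⟨e, he⟩ := exists_algHom_ker_eq (⊥ : Ideal C.R)
      have h : C.x - algebraMap ℂ C.R (e C.x) = 0 := (he _).2 (by simp)
      refine X_sub_C_ne_zero (e C.x) (C.aeval_x_eq_zero ?_)
      simpa using h
    have hfield : ¬ IsField L := IsLocalization.AtPrime.not_isField C.R hm0 L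
    exact ((IsDiscreteValuationRing.TFAE L hfield).out 4 0).1
      (C.isPrincipal_maximalIdeal_localization m L)
  isFractionRing := by
    change IsFractionRing (Localization.subalgebra.ofField C.K m.primeCompl
      m.primeCompl_le_nonZeroDivisors) C.K
    infer_instance

theorem mem_affinePoint_iff {m : Ideal C.R} [hm : m.IsMaximal] {f : C.K} :
    f ∈ (C.affinePoint m).ring ↔
      ∃ u s : C.R, s ∉ m ∧ f = algebraMap C.R C.K u * (algebraMap C.R C.K s)⁻¹ := by
  constructor
  · rintro ⟨u, s, hs, h⟩
    exact ⟨u, s, hs, h⟩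
  · rintro ⟨u, s, hs, h⟩
    exact ⟨u, s, hs, h⟩

theorem algebraMap_mem_affinePoint (m : Ideal C.R) [hm : m.IsMaximal] (u : C.R) :
    algebraMap C.R C.K u ∈ (C.affinePoint m).ring :=
  C.mem_affinePoint_iff.2 ⟨u, 1, (Ideal.ne_top_iff_one m).1 hm.ne_top, by simp⟩

/-! ### Differentials regular on the affine curve -/

/-- A differential that is regular at the point of a maximal ideal `m` has the form
`f dx / (s y_r̂ y_ŝ)` with `s ∉ m` and `f` vanishing at the branch points. -/
theorem exists_smul_eq_form {m : Ideal C.R} [hm : m.IsMaximal] {ω : Ω[C.K⁄ℂ]}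
    (hω : ω ∈ (C.affinePoint m).regularDifferentials) :
    ∃ s ∉ m, ∃ f ∈ C.RHat, algebraMap C.R C.K s • ω = C.form f := by
  have hprime := hm.isPrime
  refine CurvePoint.regularDifferentials_induction (C.affinePoint m) (p := fun ω => ∃ s ∉ m,
    ∃ f ∈ C.RHat, algebraMap C.R C.K s • ω = C.form f) ?_ ?_ ?_ ?_ hω
  · intro a ha
    obtain ⟨u, s, hs, rfl⟩ := C.mem_affinePoint_iff.1 ha
    obtain ⟨f, hf, hfu⟩ := C.exists_form_eq_D u
    obtain ⟨g, hg, hgs⟩ := C.exists_form_eq_D s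
    have hs0 : algebraMap C.R C.K s ≠ 0 := by
      rw [Ne, map_eq_zero_iff _ C.algebraMap_injective]
      rintro rfl
      exact hs m.zero_mem
    refine ⟨s ^ 2, fun h => hs (hprime.mem_of_pow_mem 2 h), s * f - u * g,
      sub_mem (C.mul_mem_RHat _ hf) (C.mul_mem_RHat _ hg), ?_⟩
    rw [← div_eq_mul_inv, Derivation.leibniz_div, hfu, hgs, smul_smul, map_pow, ← mul_pow,
      mul_inv_cancel₀ hs0, one_pow, one_smul, ← form_mul, ← form_mul]
    exact (C.formLinearMap.map_sub _ _).symm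
  · refine ⟨1, (Ideal.ne_top_iff_one m).1 hm.ne_top, 0, zero_mem _, ?_⟩
    rw [smul_zero]
    exact C.formLinearMap.map_zero.symm
  · rintro ω η ⟨s, hs, f, hf, h1⟩ ⟨s', hs', f', hf', h2⟩
    refine ⟨s * s', hprime.mul_notMem hs hs', s' * f + s * f',
      add_mem (C.mul_mem_RHat _ hf) (C.mul_mem_RHat _ hf'), ?_⟩
    rw [form_add, C.form_mul s', C.form_mul s, ← h1, ← h2, smul_smul, smul_smul, smul_add,
      map_mul, mul_comm (algebraMap C.R C.K s')]
  · rintro a ha ω ⟨s, hs, f, hf, h⟩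
    obtain ⟨u, s', hs', rfl⟩ := C.mem_affinePoint_iff.1 ha
    have hs0 : algebraMap C.R C.K s' ≠ 0 := by
      rw [Ne, map_eq_zero_iff _ C.algebraMap_injective]
      rintro rfl
      exact hs' m.zero_mem
    refine ⟨s' * s, hprime.mul_notMem hs' hs, u * f, C.mul_mem_RHat _ hf, ?_⟩
    rw [form_mul, ← h, smul_smul, smul_smul, map_mul]
    congr 1
    field_simp

theorem formLinearMap_injective : Function.Injective C.formLinearMap := by
  rw [injective_iff_map_eq_zero]
  intro f hf
  have hf : C.form f = 0 := hf
  rw [form, smul_eq_zero, or_iff_left C.D_xK_ne_zero, div_eq_zero_iff,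
    or_iff_left C.yrK_mul_ysK_ne_zero] at hf
  exact (map_eq_zero_iff _ C.algebraMap_injective).1 hf

/-- The differentials that are regular at all points where `x` is regular are the
`f dx / (y_r̂ y_ŝ)` with `f` vanishing at the branch points. -/
theorem exists_form_eq_of_regular {ω : Ω[C.K⁄ℂ]}
    (hω : ∀ P : CurvePoint ℂ C.K, C.xK ∈ P.ring → ω ∈ P.regularDifferentials) :
    ∃ f ∈ C.RHat, ω = C.form f := by
  -- the ideal of denominators of `ω` lies in no maximal ideal
  let I : Ideal C.R :=
    { carrier := {c | ∃ f ∈ C.RHat, algebraMap C.R C.K c • ω = C.form f}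
      add_mem' := by
        rintro c c' ⟨f, hf, h⟩ ⟨f', hf', h'⟩
        exact ⟨f + f', add_mem hf hf', by rw [map_add, add_smul, h, h', form_add]⟩
      zero_mem' := ⟨0, zero_mem _, by
        rw [map_zero, zero_smul]
        exact C.formLinearMap.map_zero.symm⟩
      smul_mem' := by
        rintro u c ⟨f, hf, h⟩
        exact ⟨u * f, C.mul_mem_RHat _ hf, by rw [form_mul, ← h, smul_smul, smul_eq_mul, map_mul]⟩ }
  have hI : I = ⊤ := by
    by_contra hI
    obtain ⟨m, hm, hIm⟩ := I.exists_le_maximal hI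
    obtain ⟨s, hs, f, hf, h⟩ := C.exists_smul_eq_form (m := m)
      (hω (C.affinePoint m) (C.algebraMap_mem_affinePoint m C.x))
    exact hs (hIm ⟨f, hf, h⟩)
  obtain ⟨f, hf, h⟩ := (Ideal.eq_top_iff_one I).1 hI
  exact ⟨f, hf, by rw [← h, map_one, one_smul]⟩

end TrigonalData

/-! ### Differentials at a pole of `x` -/

section LogarithmicBound

open Polynomial

theorem Polynomial.coeff_X_mul_derivative {k : Type*} [CommRing k] (p : k[X]) (n : ℕ) :
    (X * derivative p).coeff n = n * p.coeff n := by
  cases n with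
  | zero => simp
  | succ n => rw [coeff_X_mul, coeff_derivative, mul_comm]; push_cast; rfl

theorem Polynomial.natDegree_X_mul_derivative_le {k : Type*} [CommRing k] (p : k[X]) :
    (X * derivative p).natDegree ≤ p.natDegree := by
  rw [natDegree_le_iff_coeff_eq_zero]
  intro n hn
  rw [coeff_X_mul_derivative, coeff_eq_zero_of_natDegree_lt hn, mul_zero]

theorem Polynomial.natDegree_X_mul_logNum_le {k : Type*} [CommRing k] (p q : k[X]) :
    (X * (2 * derivative p * q + p * derivative q)).natDegree ≤ p.natDegree + q.natDegree := by
  have h : X * (2 * derivative p * q + p * derivative q)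
      = C 2 * ((X * derivative p) * q) + p * (X * derivative q) := by
    rw [map_ofNat]
    ring
  rw [h]
  refine (natDegree_add_le _ _).trans (max_le ?_ ?_)
  · exact (natDegree_C_mul_le _ _).trans (natDegree_mul_le_of_le
      (natDegree_X_mul_derivative_le p) le_rfl)
  · exact natDegree_mul_le_of_le le_rfl (natDegree_X_mul_derivative_le q)

theorem Polynomial.coeff_X_mul_logNum {k : Type*} [CommRing k] {p q : k[X]} (hp : p.Monic)
    (hq : q.Monic) :
    (X * (2 * derivative p * q + p * derivative q)).coeff (p.natDegree + q.natDegree)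
      = 2 * (p.natDegree : k) + q.natDegree := by
  have h : X * (2 * derivative p * q + p * derivative q)
      = C 2 * ((X * derivative p) * q) + p * (X * derivative q) := by
    rw [map_ofNat]
    ring
  rw [h, coeff_add, coeff_C_mul,
    coeff_mul_add_eq_of_natDegree_le (natDegree_X_mul_derivative_le p) le_rfl,
    coeff_mul_add_eq_of_natDegree_le le_rfl (natDegree_X_mul_derivative_le q),
    coeff_X_mul_derivative, coeff_X_mul_derivative, hp.coeff_natDegree, hq.coeff_natDegree]
  ring

namespace Valuation

theorem map_three (k : Type*) {K Γ₀ : Type*} [Field k] [CharZero k] [Field K] [Algebra k K]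
    [LinearOrderedCommGroupWithZero Γ₀] (v : Valuation K Γ₀) [v.IsTrivialOn k] :
    v (3 : K) = 1 := by
  have h := IsTrivialOn.eq_one (v := v) (3 : k) three_ne_zero
  rwa [map_ofNat] at h

variable {k K Γ₀ M : Type*} [Field k] [Field K] [Algebra k K] [LinearOrderedCommGroupWithZero Γ₀]
  (v : Valuation K Γ₀) [AddCommGroup M] [Module k M] [Module K M]
  (d : Derivation k K M) (x : K)

/-- `df` is a multiple `h dx` of `dx` with `v (h x) ≤ γ`. -/
def DerivBound (f : K) (γ : Γ₀) : Prop :=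
  ∃ h, d f = h • d x ∧ v h * v x ≤ γ

variable {v d x}

theorem DerivBound.add {f g : K} {γ : Γ₀} (hf : v.DerivBound d x f γ)
    (hg : v.DerivBound d x g γ) : v.DerivBound d x (f + g) γ := by
  obtain ⟨a, ha, ha'⟩ := hf
  obtain ⟨b, hb, hb'⟩ := hg
  refine ⟨a + b, by rw [map_add, ha, hb, add_smul], ?_⟩
  rw [← map_mul] at *
  rw [add_mul]
  exact v.map_add_le ha' hb'

theorem DerivBound.sum {ι : Type*} {f : ι → K} {γ : Γ₀} (s : Finset ι)
    (hf : ∀ i ∈ s, v.DerivBound d x (f i) γ) : v.DerivBound d x (∑ i ∈ s, f i) γ := by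
  classical
  induction s using Finset.induction_on with
  | empty => exact ⟨0, by simp, by simp⟩
  | insert i s hi ih =>
    rw [Finset.sum_insert hi]
    exact (hf i (Finset.mem_insert_self i s)).add
      (ih fun j hj => hf j (Finset.mem_insert_of_mem hj))

theorem DerivBound.mono {f : K} {γ γ' : Γ₀} (hf : v.DerivBound d x f γ) (h : γ ≤ γ') :
    v.DerivBound d x f γ' := by
  obtain ⟨a, ha, ha'⟩ := hf
  exact ⟨a, ha, ha'.trans h⟩

theorem DerivBound.mul {f g : K} (hf : v.DerivBound d x f (v f)) (hg : v.DerivBound d x g (v g)) :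
    v.DerivBound d x (f * g) (v (f * g)) := by
  obtain ⟨a, ha, ha'⟩ := hf
  obtain ⟨b, hb, hb'⟩ := hg
  refine ⟨f * b + g * a, by rw [d.leibniz, ha, hb, smul_smul, smul_smul, add_smul], ?_⟩
  rw [← map_mul, add_mul]
  apply v.map_add_le
  · rw [mul_assoc, map_mul, map_mul, map_mul]
    gcongr
  · rw [mul_assoc, map_mul, map_mul, map_mul, mul_comm (v f)]
    gcongr

theorem DerivBound.div {f g : K} (hf : v.DerivBound d x f (v f))
    (hg : v.DerivBound d x g (v g)) : v.DerivBound d x (f / g) (v (f / g)) := by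
  by_cases hg0 : g = 0
  · subst hg0
    exact ⟨0, by simp, by simp⟩
  have hvg : v g ≠ 0 := v.ne_zero_iff.2 hg0
  obtain ⟨a, ha, ha'⟩ := hf
  obtain ⟨b, hb, hb'⟩ := hg
  refine ⟨g⁻¹ ^ 2 * (g * a - f * b), ?_, ?_⟩
  · rw [d.leibniz_div, ha, hb, smul_smul, smul_smul, ← sub_smul, smul_smul]
  · have e : g⁻¹ ^ 2 * (g * a - f * b) * x = (a * x) / g - f * (b * x) / g ^ 2 := by
      field_simp
    rw [← map_mul, e]
    apply v.map_sub_le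
    · rw [map_div₀, map_div₀, map_mul]
      gcongr
      exact zero_le
    · rw [map_div₀, map_div₀, map_mul, map_mul, map_pow]
      calc v f * (v b * v x) / v g ^ 2 ≤ v f * v g / v g ^ 2 := by
            gcongr
            exact zero_le
        _ = v f / v g := by field_simp

variable [v.IsTrivialOn k]

theorem derivBound_aeval (hx : 1 < v x) (p : k[X]) :
    v.DerivBound d x (aeval x p) (v (aeval x p)) := by
  by_cases hp : p = 0
  · exact ⟨0, by simp [hp], by simp [hp]⟩
  refine ⟨aeval x (derivative p), d.map_aeval p x, ?_⟩
  have : aeval x (derivative p) * x = aeval x (X * derivative p) := by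
    rw [map_mul, aeval_X, mul_comm]
  rw [← map_mul, this, v.map_aeval_eq hx hp]
  exact v.map_aeval_le hx.le (natDegree_X_mul_derivative_le p)

variable [CharZero k] {y : K} {p q : k[X]}

omit [v.IsTrivialOn k] in
theorem _root_.Derivation.cubeRoot_eq_smul [IsScalarTower k K M] (hp : aeval x p ≠ 0)
    (hq : aeval x q ≠ 0) (hy0 : y ≠ 0) (hy : y ^ 3 = aeval x p ^ 2 * aeval x q) :
    d y = (y * aeval x (2 * derivative p * q + p * derivative q)
      / (3 * (aeval x p * aeval x q))) • d x := by
  have h3 : (3 : K) ≠ 0 := by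
    have h : algebraMap k K 3 ≠ 0 := by
      rw [Ne, map_eq_zero_iff _ (algebraMap k K).injective]
      exact three_ne_zero
    rwa [map_ofNat] at h
  have h0 : 3 * (aeval x p * aeval x q) ≠ 0 := mul_ne_zero h3 (mul_ne_zero hp hq)
  have h := d.smul_cubeRoot hp hy0 hy
  rw [div_eq_inv_mul, mul_smul, ← h, smul_smul, inv_mul_cancel₀ h0, one_smul]

omit [v.IsTrivialOn k] [CharZero k] in
theorem aeval_ne_zero_of_one_lt [v.IsTrivialOn k] (hx : 1 < v x) (hp : p ≠ 0) :
    aeval x p ≠ 0 := by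
  rw [← v.ne_zero_iff, v.map_aeval_eq hx hp]
  exact pow_ne_zero _ (zero_lt_one.trans hx).ne'

omit [CharZero k] in
theorem map_cubeRoot_pow_three (hx : 1 < v x) (hp : p ≠ 0) (hq : q ≠ 0)
    (hy : y ^ 3 = aeval x p ^ 2 * aeval x q) :
    v y ^ 3 = v x ^ (2 * p.natDegree + q.natDegree) := by
  rw [← map_pow, hy, map_mul, map_pow, v.map_aeval_eq hx hp, v.map_aeval_eq hx hq, ← pow_mul,
    ← pow_add, mul_comm 2]

theorem derivBound_cubeRoot [IsScalarTower k K M] (hx : 1 < v x) (hp : p ≠ 0) (hq : q ≠ 0)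
    (hy0 : y ≠ 0) (hy : y ^ 3 = aeval x p ^ 2 * aeval x q) : v.DerivBound d x y (v y) := by
  have hp0 := aeval_ne_zero_of_one_lt hx hp
  have hq0 := aeval_ne_zero_of_one_lt hx hq
  refine ⟨_, d.cubeRoot_eq_smul hp0 hq0 hy0 hy, ?_⟩
  have h : y * aeval x (2 * derivative p * q + p * derivative q)
      / (3 * (aeval x p * aeval x q)) * x
      = y * aeval x (X * (2 * derivative p * q + p * derivative q))
        / (3 * (aeval x p * aeval x q)) := by
    rw [map_mul (aeval x) X, aeval_X]
    ring
  rw [← map_mul, h, map_div₀, map_mul v, map_mul v, v.map_three k, one_mul, ← map_mul (aeval x) p,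
    v.map_aeval_eq hx (mul_ne_zero hp hq), natDegree_mul hp hq, mul_div_assoc]
  refine mul_le_of_le_one_right' (div_le_one_of_le₀ ?_ zero_le)
  exact v.map_aeval_le hx.le (natDegree_X_mul_logNum_le p q)

/-- If `y³ = p² q` has pole order `3 a + 1` in the normalization where `x` has pole order `3`, then
`t = x ^ a / y` is a uniformizer, and the bound on `dt` is attained: the leading coefficient of
`3 (dt / t) / (dx / x)` is `3 a - (3 a + 1) = -1`. -/
theorem exists_D_div_cubeRoot [IsScalarTower k K M] (hx : 1 < v x) (hp : p.Monic) (hq : q.Monic)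
    (hy0 : y ≠ 0) (hy : y ^ 3 = aeval x p ^ 2 * aeval x q) {a : ℕ}
    (ha : 2 * p.natDegree + q.natDegree = 3 * a + 1) :
    ∃ h, d (x ^ a / y) = h • d x ∧ v h * v x = v (x ^ a / y) := by
  have hp0 := aeval_ne_zero_of_one_lt hx hp.ne_zero
  have hq0 := aeval_ne_zero_of_one_lt hx hq.ne_zero
  have hx0 : x ≠ 0 := v.ne_zero_iff.1 (zero_lt_one.trans hx).ne'
  have hda : d (x ^ a) = aeval x (derivative (X ^ a : k[X])) • d x := by
    rw [← d.map_aeval, map_pow (aeval x), aeval_X]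
  refine ⟨_, by rw [d.leibniz_div, hda, d.cubeRoot_eq_smul hp0 hq0 hy0 hy, smul_smul, smul_smul,
    ← sub_smul, smul_smul], ?_⟩
  set A := 2 * derivative p * q + p * derivative q with hA
  set Q : k[X] := C (3 * a : k) * (p * q) - X * A with hQ
  have h3 : (3 : K) ≠ 0 := by
    rw [← v.ne_zero_iff, v.map_three k]
    exact one_ne_zero
  have hQx : aeval x Q = 3 * a * (aeval x p * aeval x q) - x * aeval x A := by
    simp only [hQ, _root_.map_sub, map_mul, aeval_X, map_ofNat, map_natCast]
  have hxa : aeval x (derivative (X ^ a : k[X])) * x = a * x ^ a := by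
    have h : derivative (X ^ a : k[X]) * X = C (a : k) * X ^ a := by
      cases a with
      | zero => simp
      | succ n => rw [derivative_X_pow, Nat.add_sub_cancel, mul_assoc, ← pow_succ]
    have := congrArg (aeval x) h
    simpa using this
  have key : y⁻¹ ^ 2 * (y * aeval x (derivative (X ^ a : k[X]))
      - x ^ a * (y * aeval x A / (3 * (aeval x p * aeval x q)))) * x
      = x ^ a / y * aeval x Q / (3 * (aeval x p * aeval x q)) := by
    rw [hQx]
    have : y⁻¹ ^ 2 * (y * aeval x (derivative (X ^ a : k[X]))
      - x ^ a * (y * aeval x A / (3 * (aeval x p * aeval x q)))) * x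
      = y⁻¹ ^ 2 * (y * (aeval x (derivative (X ^ a : k[X])) * x)
      - x ^ a * (y * aeval x A / (3 * (aeval x p * aeval x q))) * x) := by ring
    rw [this, hxa]
    field_simp
  have hcoeff : Q.coeff (p.natDegree + q.natDegree) = -1 := by
    have h : ((2 * p.natDegree + q.natDegree : ℕ) : k) = ((3 * a + 1 : ℕ) : k) := by rw [ha]
    push_cast at h
    rw [hQ, coeff_sub, coeff_C_mul, coeff_X_mul_logNum hp hq,
      coeff_mul_add_eq_of_natDegree_le le_rfl le_rfl, hp.coeff_natDegree, hq.coeff_natDegree]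
    linear_combination -h
  have hdeg : Q.natDegree = p.natDegree + q.natDegree := by
    refine natDegree_eq_of_le_of_coeff_ne_zero ?_ (by rw [hcoeff]; exact neg_ne_zero.2 one_ne_zero)
    refine (natDegree_sub_le _ _).trans (max_le ?_ (natDegree_X_mul_logNum_le p q))
    exact (natDegree_C_mul_le _ _).trans natDegree_mul_le
  have hQ0 : Q ≠ 0 := by
    intro h
    rw [h, coeff_zero] at hcoeff
    exact neg_ne_zero.2 one_ne_zero hcoeff.symm
  have hpq := mul_ne_zero hp.ne_zero hq.ne_zero
  rw [← map_mul, key, map_div₀, map_mul, map_mul v 3, v.map_three k, one_mul,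
    ← map_mul (aeval x) p, v.map_aeval_eq hx hpq, v.map_aeval_eq hx hQ0, hdeg,
    natDegree_mul hp.ne_zero hq.ne_zero, mul_div_cancel_right₀]
  exact pow_ne_zero _ (zero_lt_one.trans hx).ne'

end Valuation
end LogarithmicBound

/-! ### Discrete valuation rings and valuations -/

section Places

variable {k K : Type*} [Field k] [Field K] [Algebra k K]

/-- The valuation ring of a point, as a `ValuationSubring`. -/
def CurvePoint.valuationSubring (P : CurvePoint k K) : ValuationSubring K :=
  ValuationSubring.ofSubring P.ring.toSubring fun f => by
    have := P.isDVR
    have := P.isFractionRing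
    rcases ValuationRing.isInteger_or_isInteger P.ring f with ⟨a, ha⟩ | ⟨a, ha⟩
    · exact Or.inl (ha ▸ a.2)
    · exact Or.inr (ha ▸ a.2)

theorem CurvePoint.valuation_le_one_iff (P : CurvePoint k K) {f : K} :
    P.valuationSubring.valuation f ≤ 1 ↔ f ∈ P.ring :=
  P.valuationSubring.valuation_le_one_iff f

theorem ValuationSubring.isTrivialOn_valuation (B : ValuationSubring K)
    (hB : ∀ c : k, algebraMap k K c ∈ B) : B.valuation.IsTrivialOn k := by
  refine ⟨fun c hc => le_antisymm ((B.valuation_le_one_iff _).2 (hB c)) ?_⟩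
  rw [Valuation.one_le_val_iff _ (by simpa using hc), ← map_inv₀ (algebraMap k K)]
  exact (B.valuation_le_one_iff _).2 (hB c⁻¹)

instance CurvePoint.isTrivialOn_valuation (P : CurvePoint k K) :
    P.valuationSubring.valuation.IsTrivialOn k :=
  P.valuationSubring.isTrivialOn_valuation fun c => P.ring.algebraMap_mem c

/-- A valuation ring in which the valuation of every nonzero element is an integral power of that
of `t`, where `v t < 1`, is discrete. -/
theorem Valuation.isDiscreteValuationRing_of_zpow {Γ₀ : Type*} [LinearOrderedCommGroupWithZero Γ₀]
    (v : Valuation K Γ₀) (O : Subalgebra k K) (hO : ∀ f, f ∈ O ↔ v f ≤ 1) {t : K} (ht : v t < 1)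
    (ht0 : t ≠ 0) (h : ∀ f : K, f ≠ 0 → ∃ n : ℤ, v f = v t ^ n) : IsDiscreteValuationRing O := by
  have hvt : 0 < v t := v.pos_iff.2 ht0
  have hunit : ∀ f : O, IsUnit f ↔ v f = 1 := by
    intro f
    constructor
    · rintro ⟨u, rfl⟩
      refine le_antisymm ((hO _).1 (u : O).2) ?_
      have h1 : v ((u : O) : K) * v ((↑u⁻¹ : O) : K) = 1 := by
        rw [← map_mul, ← O.coe_mul, Units.mul_inv, O.coe_one, map_one]
      rw [← h1]
      exact mul_le_of_le_one_right' ((hO _).1 (↑u⁻¹ : O).2)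
    · intro hf
      have hf0 : (f : K) ≠ 0 := v.ne_zero_iff.1 (hf ▸ one_ne_zero)
      refine IsUnit.of_mul_eq_one ⟨(f : K)⁻¹, (hO _).2 (by rw [map_inv₀, hf, inv_one])⟩ ?_
      exact Subtype.ext (mul_inv_cancel₀ hf0)
  have hnat : ∀ f : O, f ≠ 0 → ∃ n : ℕ, v f = v t ^ n := by
    intro f hf
    obtain ⟨n, hn⟩ := h f (by simpa using hf)
    have h1 := (hO _).1 f.2
    rw [hn] at h1
    have hn0 : 0 ≤ n := by
      by_contra hneg
      exact absurd h1 (not_le.2 (one_lt_zpow_of_neg₀ hvt ht (not_le.1 hneg)))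
    obtain ⟨m, rfl⟩ := Int.eq_ofNat_of_zero_le hn0
    exact ⟨m, by rw [hn]; exact zpow_natCast _ _⟩
  let τ : O := ⟨t, (hO t).2 ht.le⟩
  have hτ : Irreducible τ := by
    refine ⟨fun hu => ht.ne ((hunit τ).1 hu), fun a b hab => ?_⟩
    have hab' : t = a * b := congrArg Subtype.val hab
    have ha0 : a ≠ 0 := by rintro rfl; exact ht0 (by rw [hab']; simp)
    have hb0 : b ≠ 0 := by rintro rfl; exact ht0 (by rw [hab']; simp)
    obtain ⟨i, hi⟩ := hnat a ha0
    obtain ⟨j, hj⟩ := hnat b hb0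
    have hv : v t ^ 1 = v t ^ (i + j) := by
      rw [pow_one, pow_add, ← hi, ← hj, ← map_mul, ← hab']
    have hij : 1 = i + j := pow_right_injective₀ hvt ht.ne hv
    rcases Nat.eq_zero_or_pos i with h0 | h0
    · left
      rw [hunit, hi, h0, pow_zero]
    · right
      have : j = 0 := by omega
      rw [hunit, hj, this, pow_zero]
  refine IsDiscreteValuationRing.ofHasUnitMulPowIrreducibleFactorization ⟨τ, hτ, fun {f} hf => ?_⟩
  obtain ⟨n, hn⟩ := hnat f hf
  have hvu : v (f / t ^ n) = 1 := by
    rw [map_div₀, map_pow, hn, div_self (pow_ne_zero _ hvt.ne')]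
  let u : O := ⟨f / t ^ n, (hO _).2 hvu.le⟩
  obtain ⟨u', hu'⟩ := (hunit u).2 hvu
  refine ⟨n, u', ?_⟩
  rw [hu']
  exact Subtype.ext (mul_div_cancel₀ _ (pow_ne_zero _ ht0))

end Places

namespace TrigonalData

variable (C : TrigonalData)

open Polynomial KaehlerDifferential

/-! ### The point at infinity -/

/-- The basis `1, y_r̂, y_ŝ` of `R` over `ℂ[x]`. -/
def basisR : Fin 3 → C.K := ![1, C.yrK, C.ysK]

/-- The weights of `1, y_r̂, y_ŝ`. -/
def weightR : Fin 3 → ℕ := ![0, C.rHat, C.sHat]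

/-- The basis `y_r̂ y_ŝ, y_r̂, y_ŝ` over `ℂ[x]` of the functions vanishing at the branch points. -/
def basisRHat : Fin 3 → C.K := ![C.yrK * C.ysK, C.yrK, C.ysK]

/-- The weights of `y_r̂ y_ŝ, y_r̂, y_ŝ`. -/
def weightRHat : Fin 3 → ℕ := ![C.rHat + C.sHat, C.rHat, C.sHat]

theorem rHat_add_sHat : C.rHat + C.sHat = 3 * (C.r + C.s) := by
  rw [rHat, sHat]
  ring

theorem weightR_mod_injective : Function.Injective fun i => C.weightR i % 3 := by
  have h1 := C.rHat_add_sHat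
  have h2 := C.rHat_mod_ne_zero
  intro i j h
  fin_cases i <;> fin_cases j <;> simp [weightR] at h ⊢ <;> omega

theorem weightRHat_mod_injective : Function.Injective fun i => C.weightRHat i % 3 := by
  have h1 := C.rHat_add_sHat
  have h2 := C.rHat_mod_ne_zero
  intro i j h
  fin_cases i <;> fin_cases j <;> simp [weightRHat] at h ⊢ <;> omega

theorem algebraMap_eq_sum (u : C.R) :
    ∃ p : Fin 3 → ℂ[X], algebraMap C.R C.K u = ∑ j, aeval C.xK (p j) * C.basisR j := by
  obtain ⟨p, q, t, rfl⟩ := C.exists_normalForm u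
  refine ⟨![p, q, t], ?_⟩
  rw [Fin.sum_univ_three, map_add, map_add, map_mul, map_mul, algebraMap_aeval, algebraMap_aeval,
    algebraMap_aeval]
  simp [basisR]

theorem algebraMap_eq_sum_of_mem_RHat {u : C.R} (hu : u ∈ C.RHat) :
    ∃ p : Fin 3 → ℂ[X], algebraMap C.R C.K u = ∑ j, aeval C.xK (p j) * C.basisRHat j := by
  obtain ⟨p, q, t, rfl⟩ := C.mem_RHat_iff.1 hu
  refine ⟨![p, q, t], ?_⟩
  rw [Fin.sum_univ_three, map_add, map_add, map_mul, map_mul, map_mul, map_mul, algebraMap_aeval,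
    algebraMap_aeval, algebraMap_aeval]
  simp [basisRHat]

/-- There is a valuation ring of `K` over `ℂ` in which `x` has a pole. -/
theorem exists_valuationSubring_pole :
    ∃ B : ValuationSubring C.K, (∀ c : ℂ, algebraMap ℂ C.K c ∈ B) ∧ C.xK ∉ B := by
  let A : Subalgebra ℂ C.K := Algebra.adjoin ℂ {C.xK⁻¹}
  let ξ : A.toSubring := ⟨C.xK⁻¹, Algebra.self_mem_adjoin_singleton ℂ _⟩
  have hI : Ideal.span {ξ} ≠ ⊤ := by
    rw [Ne, Ideal.span_singleton_eq_top, isUnit_iff_exists_inv]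
    rintro ⟨⟨w, hw⟩, hξ⟩
    have hw' : w ∈ Algebra.adjoin ℂ {C.xK⁻¹} := hw
    rw [Algebra.adjoin_singleton_eq_range_aeval] at hw'
    obtain ⟨p, rfl⟩ := hw'
    have h : C.xK⁻¹ * aeval C.xK⁻¹ p = 1 := congrArg Subtype.val hξ
    have htr : Transcendental ℂ C.xK⁻¹ := fun h => C.transcendental_xK (by simpa using h.inv)
    have h0 : (X * p - 1 : ℂ[X]) = 0 := by
      by_contra hne
      refine htr ⟨_, hne, ?_⟩
      rw [map_sub, map_mul, aeval_X, map_one, h, sub_self]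
    have := congrArg (eval 0) h0
    simp at this
  obtain ⟨B, hAB, hB⟩ := Ideal.image_subset_nonunits_valuationSubring _ hI
  refine ⟨B, fun c => hAB (A.algebraMap_mem c), fun hx => ?_⟩
  have h1 : C.xK⁻¹ ∈ B.nonunits := hB ⟨ξ, Ideal.mem_span_singleton_self ξ, rfl⟩
  rw [ValuationSubring.mem_nonunits_iff, map_inv₀] at h1
  rw [← B.valuation_le_one_iff] at hx
  exact absurd h1 (not_lt.2 ((one_le_inv₀ (zero_lt_iff.2 (by simpa using C.xK_ne_zero))).2 hx))

section Pole

variable {Γ₀ : Type*} [LinearOrderedCommGroupWithZero Γ₀] {v : Valuation C.K Γ₀}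
  [v.IsTrivialOn ℂ] {C} (hx : 1 < v C.xK)

include hx

theorem valuation_yrK : v C.yrK ^ 3 = v C.xK ^ C.rHat := by
  rw [Valuation.map_cubeRoot_pow_three hx C.kr_monic.ne_zero C.ks_monic.ne_zero C.yrK_pow_three,
    natDegree_kr, natDegree_ks, rHat]

theorem valuation_ysK : v C.ysK ^ 3 = v C.xK ^ C.sHat := by
  rw [Valuation.map_cubeRoot_pow_three hx C.ks_monic.ne_zero C.kr_monic.ne_zero C.ysK_pow_three,
    natDegree_kr, natDegree_ks, sHat]

theorem valuation_basisR (j : Fin 3) : v (C.basisR j) ^ 3 = v C.xK ^ C.weightR j := by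
  fin_cases j
  · simp [basisR, weightR]
  · exact valuation_yrK hx
  · exact valuation_ysK hx

theorem valuation_basisRHat (j : Fin 3) :
    v (C.basisRHat j) ^ 3 = v C.xK ^ C.weightRHat j := by
  fin_cases j
  · change v (C.yrK * C.ysK) ^ 3 = v C.xK ^ (C.rHat + C.sHat)
    rw [map_mul, mul_pow, valuation_yrK hx, valuation_ysK hx, pow_add]
  · exact valuation_yrK hx
  · exact valuation_ysK hx

theorem valuation_monomial (e : Exponent) :
    v (algebraMap C.R C.K (C.monomial e)) ^ 3 = v C.xK ^ C.wt e := by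
  simp only [monomial, wt, map_mul, map_pow, mul_pow]
  rw [pow_right_comm _ e.i, pow_right_comm _ e.j, pow_right_comm _ e.l, valuation_yrK hx,
    valuation_ysK hx, pow_add, pow_add, pow_mul, pow_mul, pow_mul]

theorem exists_valuation_eq_pow {u : C.R} (hu : u ≠ 0) :
    ∃ n : ℕ, v (algebraMap C.R C.K u) ^ 3 = v C.xK ^ n := by
  obtain ⟨p, hp⟩ := C.algebraMap_eq_sum u
  have hp0 : p ≠ 0 := by
    rintro rfl
    refine hu ((map_eq_zero_iff _ C.algebraMap_injective).1 ?_)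
    rw [hp]
    simp
  obtain ⟨i, hi, hdom⟩ := exists_dominant_summand C.weightR_mod_injective hp0
  exact ⟨_, hp ▸ v.map_sum_pow_three hx (valuation_basisR hx) hi hdom⟩

/-- The pole order of a nonzero function vanishing at the branch points is the weight of one of the
monomials `x^a y_r̂ y_ŝ`, `x^a y_r̂`, `x^a y_ŝ`. -/
theorem exists_valuation_eq_wt {u : C.R} (hu : u ∈ C.RHat) (hu0 : u ≠ 0) :
    ∃ e : Exponent, (e.j = 1 ∧ e.l = 1 ∨ e.j = 1 ∧ e.l = 0 ∨ e.j = 0 ∧ e.l = 1) ∧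
      v (algebraMap C.R C.K u) ^ 3 = v C.xK ^ C.wt e := by
  obtain ⟨p, hp⟩ := C.algebraMap_eq_sum_of_mem_RHat hu
  have hp0 : p ≠ 0 := by
    rintro rfl
    refine hu0 ((map_eq_zero_iff _ C.algebraMap_injective).1 ?_)
    rw [hp]
    simp
  obtain ⟨i, hi, hdom⟩ := exists_dominant_summand C.weightRHat_mod_injective hp0
  have h := v.map_sum_pow_three hx (valuation_basisRHat hx) hi hdom
  rw [← hp] at h
  refine ⟨⟨(p i).natDegree, ![1, 1, 0] i, ![1, 0, 1] i⟩, ?_, ?_⟩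
  · fin_cases i <;> simp
  · rw [h, wt]
    congr 1
    fin_cases i <;> simp [weightRHat]; ring

theorem exists_sub_lt {u w : C.R} (hu : u ≠ 0)
    (huw : v (algebraMap C.R C.K u) = v (algebraMap C.R C.K w)) :
    ∃ c : ℂ, v (algebraMap C.R C.K (u - c • w)) < v (algebraMap C.R C.K u) := by
  obtain ⟨c, hc⟩ := v.exists_map_sub_lt C.weightR_mod_injective hx (valuation_basisR hx)
    (C.algebraMap_eq_sum u) (C.algebraMap_eq_sum w)
    (by rwa [Ne, map_eq_zero_iff _ C.algebraMap_injective]) huw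
  refine ⟨c, ?_⟩
  have h : c • w = algebraMap ℂ C.R c * w := Algebra.smul_def c w
  rwa [h, map_sub, map_mul, ← IsScalarTower.algebraMap_apply ℂ C.R C.K]

/-- Any two places at which `x` has a pole coincide: the pole orders of functions in `R` are
determined by their normal form. -/
theorem isEquiv_of_pole {Γ₀' : Type*} [LinearOrderedCommGroupWithZero Γ₀'] {v' : Valuation C.K Γ₀'}
    [v'.IsTrivialOn ℂ] (hx' : 1 < v' C.xK) : v.IsEquiv v' := by
  have key : ∀ u : C.R, u ≠ 0 → ∃ n : ℕ, v (algebraMap C.R C.K u) ^ 3 = v C.xK ^ n ∧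
      v' (algebraMap C.R C.K u) ^ 3 = v' C.xK ^ n := by
    intro u hu
    obtain ⟨p, hp⟩ := C.algebraMap_eq_sum u
    have hp0 : p ≠ 0 := by
      rintro rfl
      refine hu ((map_eq_zero_iff _ C.algebraMap_injective).1 ?_)
      rw [hp]
      simp
    obtain ⟨i, hi, hdom⟩ := exists_dominant_summand C.weightR_mod_injective hp0
    exact ⟨_, hp ▸ v.map_sum_pow_three hx (valuation_basisR hx) hi hdom,
      hp ▸ v'.map_sum_pow_three hx' (valuation_basisR hx') hi hdom⟩
  refine Valuation.isEquiv_of_val_le_one fun f => ?_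
  obtain ⟨u, s, hs, rfl⟩ := IsFractionRing.div_surjective C.R f
  have hs0 : s ≠ 0 := nonZeroDivisors.ne_zero hs
  by_cases hu0 : u = 0
  · simp [hu0]
  have hs' : algebraMap C.R C.K s ≠ 0 := by rwa [Ne, map_eq_zero_iff _ C.algebraMap_injective]
  obtain ⟨m, h1, h1'⟩ := key u hu0
  obtain ⟨n, h2, h2'⟩ := key s hs0
  rw [map_div₀, map_div₀, div_le_one₀ (v.pos_iff.2 hs'), div_le_one₀ (v'.pos_iff.2 hs'),
    ← v.pow_three_le_iff, ← v'.pow_three_le_iff, h1, h1', h2, h2', pow_le_pow_iff_right₀ hx,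
    pow_le_pow_iff_right₀ hx']

/-- A uniformizer `t` at a pole of `x`, of the form `x ^ a / y_r̂` or `x ^ a / y_ŝ`, together with
`dt / dx`. -/
theorem exists_uniformizer : ∃ t h : C.K, v t ^ 3 * v C.xK = 1 ∧
    D ℂ C.K t = h • D ℂ C.K C.xK ∧ v h * v C.xK = v t := by
  have h1 := C.rHat_add_sHat
  have h2 := C.rHat_mod_ne_zero
  have hx0 : v C.xK ≠ 0 := (zero_lt_one.trans hx).ne'
  have hval : ∀ (y : C.K) (a : ℕ), v y ^ 3 = v C.xK ^ (3 * a + 1) →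
      v (C.xK ^ a / y) ^ 3 * v C.xK = 1 := by
    intro y a hy
    rw [map_div₀, div_pow, hy, map_pow, ← pow_mul, mul_comm a, pow_succ, div_mul_eq_mul_div,
      div_self (mul_ne_zero (pow_ne_zero _ hx0) hx0)]
  rcases (by omega : C.rHat % 3 = 1 ∨ C.sHat % 3 = 1) with h | h
  · have ha : C.rHat = 3 * (C.rHat / 3) + 1 := by omega
    obtain ⟨g, hg, hg'⟩ := Valuation.exists_D_div_cubeRoot (d := D ℂ C.K) hx C.kr_monic C.ks_monic
      C.yrK_ne_zero C.yrK_pow_three (a := C.rHat / 3)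
      (by rw [natDegree_kr, natDegree_ks]; exact ha)
    exact ⟨_, g, hval _ _ (ha ▸ valuation_yrK hx), hg, hg'⟩
  · have ha : C.sHat = 3 * (C.sHat / 3) + 1 := by omega
    obtain ⟨g, hg, hg'⟩ := Valuation.exists_D_div_cubeRoot (d := D ℂ C.K) hx C.ks_monic C.kr_monic
      C.ysK_ne_zero C.ysK_pow_three (a := C.sHat / 3)
      (by rw [natDegree_kr, natDegree_ks]; exact ha)
    exact ⟨_, g, hval _ _ (ha ▸ valuation_ysK hx), hg, hg'⟩

theorem isDiscreteValuationRing_of_pole (O : Subalgebra ℂ C.K) (hO : ∀ f, f ∈ O ↔ v f ≤ 1) :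
    IsDiscreteValuationRing O := by
  obtain ⟨t, -, ht, -, -⟩ := exists_uniformizer hx
  have hx0 : v C.xK ≠ 0 := (zero_lt_one.trans hx).ne'
  have ht3 : v t ^ 3 = (v C.xK)⁻¹ := eq_inv_of_mul_eq_one_left ht
  have hvt0 : v t ≠ 0 := by
    intro h
    rw [h, zero_pow three_ne_zero, zero_mul] at ht
    exact zero_ne_one ht
  refine v.isDiscreteValuationRing_of_zpow O hO (t := t) ?_ (v.ne_zero_iff.1 hvt0) fun f hf => ?_
  · rw [← pow_lt_one_iff_of_nonneg zero_le three_ne_zero, ht3]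
    exact inv_lt_one_of_one_lt₀ hx
  · obtain ⟨u, s, hs, rfl⟩ := IsFractionRing.div_surjective C.R f
    have hs0 : s ≠ 0 := nonZeroDivisors.ne_zero hs
    have hu0 : u ≠ 0 := by
      rintro rfl
      simp at hf
    obtain ⟨m, hm⟩ := exists_valuation_eq_pow hx hu0
    obtain ⟨n, hn⟩ := exists_valuation_eq_pow hx hs0
    refine ⟨(n : ℤ) - m, ?_⟩
    refine (pow_left_inj₀ zero_le zero_le three_ne_zero).1 ?_
    have h3 : (v t ^ ((n : ℤ) - m)) ^ 3 = (v t ^ 3) ^ ((n : ℤ) - m) := by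
      rw [← zpow_natCast, ← zpow_natCast, ← zpow_mul, ← zpow_mul, mul_comm]
    rw [h3, map_div₀, div_pow, hm, hn, ht3, inv_zpow, ← zpow_neg, neg_sub, zpow_sub₀ hx0,
      zpow_natCast, zpow_natCast]

end Pole

end TrigonalData

namespace TrigonalData

variable (C : TrigonalData)

open Polynomial KaehlerDifferential

theorem exists_curvePoint_pole : ∃ P : CurvePoint ℂ C.K, C.xK ∉ P.ring := by
  obtain ⟨B, hB, hx⟩ := C.exists_valuationSubring_pole
  have := B.isTrivialOn_valuation hB
  let O : Subalgebra ℂ C.K := { B.toSubring with algebraMap_mem' := hB }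
  have hO : ∀ f, f ∈ O ↔ B.valuation f ≤ 1 := fun f => (B.valuation_le_one_iff f).symm
  have hx1 : 1 < B.valuation C.xK := not_le.1 fun h => hx ((B.valuation_le_one_iff _).1 h)
  have hfrac : IsFractionRing O C.K := inferInstanceAs (IsFractionRing B C.K)
  exact ⟨⟨O, isDiscreteValuationRing_of_pole hx1 O hO, hfrac⟩, hx⟩

section Points

variable {C} {P : CurvePoint ℂ C.K}

theorem one_lt_valuation (hP : C.xK ∉ P.ring) : 1 < P.valuationSubring.valuation C.xK :=
  not_le.1 fun h => hP (P.valuation_le_one_iff.1 h)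

theorem eq_of_pole {Q : CurvePoint ℂ C.K} (hP : C.xK ∉ P.ring) (hQ : C.xK ∉ Q.ring) : P = Q := by
  refine CurvePoint.ext (Subalgebra.ext fun f => ?_)
  rw [← P.valuation_le_one_iff, ← Q.valuation_le_one_iff]
  exact (isEquiv_of_pole (one_lt_valuation hP) (one_lt_valuation hQ)).le_one_iff_le_one

/-- Where `x` is regular, so are all functions in `R`: `y_r̂³` and `y_ŝ³` are polynomials in `x`. -/
theorem algebraMap_mem_ring (hP : C.xK ∈ P.ring) (u : C.R) : algebraMap C.R C.K u ∈ P.ring := by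
  have hp : ∀ p : ℂ[X], aeval C.xK p ∈ P.ring := fun p => by
    have h := Subalgebra.aeval_coe P.ring ⟨C.xK, hP⟩ p
    exact h ▸ (aeval (⟨C.xK, hP⟩ : P.ring) p).2
  have hroot : ∀ y : C.K, y ^ 3 ∈ P.ring → y ∈ P.ring := by
    intro y hy
    rw [← P.valuation_le_one_iff, map_pow] at hy
    rw [← P.valuation_le_one_iff]
    exact (pow_le_one_iff_of_nonneg zero_le three_ne_zero).1 hy
  have hyr : C.yrK ∈ P.ring := hroot _ (by
    rw [yrK_pow_three]
    exact mul_mem (pow_mem (hp _) 2) (hp _))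
  have hys : C.ysK ∈ P.ring := hroot _ (by
    rw [ysK_pow_three]
    exact mul_mem (pow_mem (hp _) 2) (hp _))
  obtain ⟨p, q, t, rfl⟩ := C.exists_normalForm u
  rw [map_add, map_add, map_mul, map_mul, algebraMap_aeval, algebraMap_aeval, algebraMap_aeval]
  exact add_mem (add_mem (hp _) (mul_mem (hp _) hyr)) (mul_mem (hp _) hys)

end Points

section Pole

variable {Γ₀ : Type*} [LinearOrderedCommGroupWithZero Γ₀] {v : Valuation C.K Γ₀}
  [v.IsTrivialOn ℂ] {C} (hx : 1 < v C.xK)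

include hx

theorem derivBound (f : C.K) : v.DerivBound (D ℂ C.K) C.xK f (v f) := by
  have hR : ∀ u : C.R, v.DerivBound (D ℂ C.K) C.xK (algebraMap C.R C.K u)
      (v (algebraMap C.R C.K u)) := by
    intro u
    obtain ⟨p, hp⟩ := C.algebraMap_eq_sum u
    rw [hp]
    refine Valuation.DerivBound.sum _ fun j _ => Valuation.DerivBound.mono
      ((Valuation.derivBound_aeval hx (p j)).mul ?_)
      (v.map_summand_le C.weightR_mod_injective hx (valuation_basisR hx) p j)
    fin_cases j
    · exact ⟨0, by simp [basisR], by simp⟩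
    · exact Valuation.derivBound_cubeRoot hx C.kr_monic.ne_zero C.ks_monic.ne_zero C.yrK_ne_zero
        C.yrK_pow_three
    · exact Valuation.derivBound_cubeRoot hx C.ks_monic.ne_zero C.kr_monic.ne_zero C.ysK_ne_zero
        C.ysK_pow_three
  obtain ⟨u, s, -, rfl⟩ := IsFractionRing.div_surjective C.R f
  exact (hR u).div (hR s)

theorem valuation_yrK_mul_ysK :
    v (C.yrK * C.ysK) ^ 3 = v C.xK ^ (3 * C.g) * v C.xK ^ 3 := by
  have h : C.rHat + C.sHat = 3 * C.g + 3 := by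
    have := C.r_lt_s
    rw [rHat_add_sHat, g]
    omega
  rw [map_mul, mul_pow, valuation_yrK hx, valuation_ysK hx, ← pow_add, h, pow_add]

end Pole

section Infinity

variable {C} {P : CurvePoint ℂ C.K} (hP : C.xK ∉ P.ring)

include hP

/-- If `f dx / (y_r̂ y_ŝ)` is regular at the pole of `x`, then `f` has pole order at most `3 g`:
the differentials `h dx` regular there satisfy `v (h x) ≤ 1`. -/
theorem valuation_le_of_form_mem {f : C.R} (hf : C.form f ∈ P.regularDifferentials) :
    P.valuationSubring.valuation (algebraMap C.R C.K f) ^ 3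
      ≤ P.valuationSubring.valuation C.xK ^ (3 * C.g) := by
  have hx := one_lt_valuation hP
  set v := P.valuationSubring.valuation
  have hx0 : v C.xK ≠ 0 := (zero_lt_one.trans hx).ne'
  have h : ∃ h : C.K, C.form f = h • D ℂ C.K C.xK ∧ v h * v C.xK ≤ 1 := by
    refine P.regularDifferentials_induction (p := fun ω => ∃ h : C.K, ω = h • D ℂ C.K C.xK ∧
      v h * v C.xK ≤ 1) ?_ ?_ ?_ ?_ hf
    · intro a ha
      exact (derivBound hx a).mono (P.valuation_le_one_iff.2 ha)
    · exact ⟨0, by simp, by simp⟩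
    · rintro ω η ⟨a, rfl, ha⟩ ⟨b, rfl, hb⟩
      refine ⟨a + b, (add_smul _ _ _).symm, ?_⟩
      rw [← map_mul] at ha hb ⊢
      rw [add_mul]
      exact v.map_add_le ha hb
    · rintro a ha ω ⟨b, rfl, hb⟩
      refine ⟨a * b, smul_smul _ _ _, ?_⟩
      rw [map_mul, mul_assoc]
      exact mul_le_one' (P.valuation_le_one_iff.2 ha) hb
  obtain ⟨h, hω, hh⟩ := h
  have h1 : algebraMap C.R C.K f / (C.yrK * C.ysK) = h :=
    smul_left_injective C.K C.D_xK_ne_zero hω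
  rw [← h1, map_div₀, div_mul_eq_mul_div,
    div_le_one₀ (v.pos_iff.2 C.yrK_mul_ysK_ne_zero)] at hh
  have h3 := pow_le_pow_left₀ zero_le hh 3
  rw [mul_pow, valuation_yrK_mul_ysK hx] at h3
  exact le_of_mul_le_mul_right h3 (pow_pos (zero_lt_iff.2 hx0) 3)

/-- If `f` has pole order less than `3 g`, then `f dx / (y_r̂ y_ŝ)` is a regular multiple of the
differential of a uniformizer at the pole of `x`. -/
theorem form_mem_of_valuation_le {f : C.R} {n : ℕ} (hn : n < 3 * C.g)
    (hf : P.valuationSubring.valuation (algebraMap C.R C.K f) ^ 3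
      = P.valuationSubring.valuation C.xK ^ n) :
    C.form f ∈ P.regularDifferentials := by
  have hx := one_lt_valuation hP
  obtain ⟨t, h, ht, hD, hh⟩ := exists_uniformizer hx
  set v := P.valuationSubring.valuation with hv
  have hx0 : v C.xK ≠ 0 := (zero_lt_one.trans hx).ne'
  have hvt : v t ≠ 0 := by
    intro h
    rw [h, zero_pow three_ne_zero, zero_mul] at ht
    exact zero_ne_one ht
  have hvh : v h ≠ 0 := by
    intro h0
    rw [h0, zero_mul] at hh
    exact hvt hh.symm
  have htP : t ∈ P.ring := by
    rw [← P.valuation_le_one_iff, ← pow_le_one_iff_of_nonneg zero_le three_ne_zero]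
    rw [← ht]
    exact le_mul_of_one_le_right' hx.le
  have hform : C.form f = (algebraMap C.R C.K f / (C.yrK * C.ysK) / h) • D ℂ C.K t := by
    rw [hD, smul_smul, div_mul_cancel₀ _ (v.ne_zero_iff.1 hvh)]
    rfl
  rw [hform]
  refine P.smul_mem_regularDifferentials ?_ (P.D_mem_regularDifferentials htP)
  rw [← P.valuation_le_one_iff, map_div₀, map_div₀, div_div]
  refine div_le_one_of_le₀ ?_ zero_le
  rw [← pow_le_pow_iff_left₀ zero_le zero_le three_ne_zero, mul_pow, hf]
  change v C.xK ^ n ≤ v (C.yrK * C.ysK) ^ 3 * v h ^ 3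
  rw [valuation_yrK_mul_ysK hx, mul_assoc, ← mul_pow, mul_comm (v C.xK) (v h), hh,
    eq_inv_of_mul_eq_one_left ht, ← div_eq_mul_inv, le_div_iff₀ (zero_lt_iff.2 hx0), ← pow_succ]
  exact pow_le_pow_right₀ hx.le hn

end Infinity

/-! ### Weights of monomials -/

theorem _root_.StrictMono.lt_iff_lt_card {u : ℕ → ℕ} (hu : StrictMono u) {B : ℕ} {S : Finset ℕ}
    (hS : ∀ w, w ∈ S ↔ w < B ∧ ∃ i, u i = w) (i : ℕ) : u i < B ↔ i < S.card := by
  classical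
  let I := (Finset.range B).filter fun i => u i < B
  have hI : ∀ i, i ∈ I ↔ u i < B := fun i => by
    simp only [I, Finset.mem_filter, Finset.mem_range, and_iff_right_iff_imp]
    exact fun h => (hu.le_apply).trans_lt h
  have hcard : S.card = I.card := by
    rw [← Finset.card_image_of_injective I hu.injective]
    congr 1
    ext w
    rw [hS, Finset.mem_image]
    constructor
    · rintro ⟨hw, i, rfl⟩
      exact ⟨i, (hI i).2 hw, rfl⟩
    · rintro ⟨i, hi, rfl⟩
      exact ⟨(hI i).1 hi, i, rfl⟩
  rw [hcard]
  constructor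
  · intro h
    have hsub : Finset.range (i + 1) ⊆ I := fun j hj =>
      (hI j).2 ((hu.monotone (Nat.lt_succ_iff.1 (Finset.mem_range.1 hj))).trans_lt h)
    simpa using Finset.card_le_card hsub
  · intro h
    by_contra hB
    have hsub : I ⊆ Finset.range i := fun j hj => Finset.mem_range.2
      (hu.lt_iff_lt.1 (((hI j).1 hj).trans_le (not_lt.1 hB)))
    have := Finset.card_le_card hsub
    rw [Finset.card_range] at this
    omega

theorem monomial_mem_RHat {e : Exponent} (he : 0 < e.j ∨ 0 < e.l) : C.monomial e ∈ C.RHat := by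
  rw [monomial]
  rcases he with h | h
  · have : C.x ^ e.i * C.yr ^ e.j * C.ys ^ e.l
        = C.x ^ e.i * C.yr ^ (e.j - 1) * C.ys ^ e.l * C.yr := by
      conv_lhs => rw [← Nat.sub_add_cancel h]
      ring
    rw [this]
    exact C.mul_mem_RHat _ C.yr_mem_RHat
  · have : C.x ^ e.i * C.yr ^ e.j * C.ys ^ e.l
        = C.x ^ e.i * C.yr ^ e.j * C.ys ^ (e.l - 1) * C.ys := by
      conv_lhs => rw [← Nat.sub_add_cancel h]
      ring
    rw [this]
    exact C.mul_mem_RHat _ C.ys_mem_RHat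

theorem monomial_ne_zero (e : Exponent) : C.monomial e ≠ 0 := by
  intro h
  have := congrArg (algebraMap C.R C.K) h
  rw [monomial, map_mul, map_mul, map_pow, map_pow, map_pow, map_zero] at this
  exact mul_ne_zero (mul_ne_zero (pow_ne_zero _ C.xK_ne_zero) (pow_ne_zero _ C.yrK_ne_zero))
    (pow_ne_zero _ C.ysK_ne_zero) this

section Weights

variable {Γ₀ : Type*} [LinearOrderedCommGroupWithZero Γ₀] {v : Valuation C.K Γ₀}
  [v.IsTrivialOn ℂ] {C} (hx : 1 < v C.xK) (φ : C.PhiHat)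

include hx

theorem exists_wt_eq {e : Exponent} (he : 0 < e.j ∨ 0 < e.l) : ∃ a : ℕ,
    C.wt e = 3 * a + (C.rHat + C.sHat) ∨ C.wt e = 3 * a + C.rHat ∨ C.wt e = 3 * a + C.sHat := by
  obtain ⟨e', he', h⟩ := exists_valuation_eq_wt hx (C.monomial_mem_RHat he) (C.monomial_ne_zero e)
  rw [valuation_monomial hx] at h
  have h' := pow_right_injective₀ (zero_lt_one.trans hx) hx.ne' h
  refine ⟨e'.i, ?_⟩
  change C.wt e = C.wt e' at h'
  rw [h', wt]
  rcases he' with ⟨h1, h2⟩ | ⟨h1, h2⟩ | ⟨h1, h2⟩ <;> rw [h1, h2] <;> omega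

/-- The first `g` weights are those below `3 g`. -/
theorem wt_lt_iff (n : ℕ) : C.wt (φ.exponent n) < 3 * C.g ↔ n < C.g := by
  classical
  have h1 := C.rHat_add_sHat
  have h2 := C.rHat_mod_ne_zero
  have h3 := C.r_lt_s
  have hg : C.g + 1 = C.r + C.s := by rw [g]; omega
  let S : Finset ℕ := (Finset.range (C.sHat / 3)).image (fun a => 3 * a + C.rHat) ∪
    (Finset.range (C.rHat / 3)).image (fun a => 3 * a + C.sHat)
  have hcard : S.card = C.g := by
    rw [Finset.card_union_of_disjoint, Finset.card_image_of_injective,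
      Finset.card_image_of_injective, Finset.card_range, Finset.card_range]
    · omega
    · intro a b h
      simp only at h
      omega
    · intro a b h
      simp only at h
      omega
    · rw [Finset.disjoint_left]
      intro w hw hw'
      simp only [Finset.mem_image, Finset.mem_range] at hw hw'
      obtain ⟨a, -, ha⟩ := hw
      obtain ⟨b, -, hb⟩ := hw'
      omega
  suffices hS : ∀ w, w ∈ S ↔ w < 3 * C.g ∧ ∃ i, C.wt (φ.exponent i) = w by
    rw [φ.wt_strictMono.lt_iff_lt_card hS n, hcard]
  intro w
  simp only [S, Finset.mem_union, Finset.mem_image, Finset.mem_range]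
  constructor
  · rintro (⟨a, ha, rfl⟩ | ⟨a, ha, rfl⟩)
    · refine ⟨by omega, ?_⟩
      obtain ⟨i, hi⟩ := φ.exhaustive ⟨a, 1, 0⟩ (Or.inl one_pos)
      exact ⟨i, by rw [hi, wt]; simp⟩
    · refine ⟨by omega, ?_⟩
      obtain ⟨i, hi⟩ := φ.exhaustive ⟨a, 0, 1⟩ (Or.inr one_pos)
      exact ⟨i, by rw [hi, wt]; simp⟩
  · rintro ⟨hw, i, rfl⟩
    obtain ⟨a, ha⟩ := exists_wt_eq hx (φ.divisible i)
    rcases ha with ha | ha | ha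
    · omega
    · exact Or.inl ⟨a, by omega, ha.symm⟩
    · exact Or.inr ⟨a, by omega, ha.symm⟩

/-- The pole order `3 g` does not occur, in accordance with the residue theorem. -/
theorem wt_ne (n : ℕ) : C.wt (φ.exponent n) ≠ 3 * C.g := by
  have h1 := C.rHat_add_sHat
  have h2 := C.rHat_mod_ne_zero
  have h3 := C.r_lt_s
  have hg : C.g + 1 = C.r + C.s := by rw [g]; omega
  obtain ⟨a, ha⟩ := exists_wt_eq hx (φ.divisible n)
  omega

/-! ### The monomial bases -/

theorem linearIndependent_fn : LinearIndependent ℂ φ.fn := by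
  classical
  rw [linearIndependent_iff']
  intro s c hsum i hi
  by_contra hci
  obtain ⟨j, hj, hmax⟩ := Finset.exists_max_image (s.filter fun i => c i ≠ 0) id
    ⟨i, by simp [hi, hci]⟩
  obtain ⟨hjs, hcj⟩ := Finset.mem_filter.1 hj
  have hval : ∀ n, c n ≠ 0 → v (algebraMap C.R C.K (c n • φ.fn n)) ^ 3
      = v C.xK ^ C.wt (φ.exponent n) := by
    intro n hn
    have h : c n • φ.fn n = algebraMap ℂ C.R (c n) * φ.fn n := Algebra.smul_def (c n) (φ.fn n)
    rw [h, map_mul, ← IsScalarTower.algebraMap_apply ℂ C.R C.K, map_mul,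
      Valuation.IsTrivialOn.eq_one _ hn, one_mul]
    exact valuation_monomial hx _
  have hne : v (algebraMap C.R C.K (c j • φ.fn j)) ≠ 0 := by
    intro h
    have := hval j hcj
    rw [h, zero_pow three_ne_zero] at this
    exact pow_ne_zero _ (zero_lt_one.trans hx).ne' this.symm
  have hlt : v (∑ n ∈ s.erase j, algebraMap C.R C.K (c n • φ.fn n))
      < v (algebraMap C.R C.K (c j • φ.fn j)) := by
    refine v.map_sum_lt hne fun n hn => ?_
    obtain ⟨hnj, hns⟩ := Finset.mem_erase.1 hn
    by_cases hcn : c n = 0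
    · rw [hcn, zero_smul, map_zero, map_zero]
      exact zero_lt_iff.2 hne
    · rw [← v.pow_three_lt_iff, hval n hcn, hval j hcj]
      refine pow_lt_pow_right₀ hx (φ.wt_strictMono (lt_of_le_of_ne ?_ hnj))
      exact hmax n (Finset.mem_filter.2 ⟨hns, hcn⟩)
  have h0 := congrArg (algebraMap C.R C.K) hsum
  rw [map_sum, map_zero, ← Finset.add_sum_erase _ _ hjs, add_comm] at h0
  have h1 := v.map_add_eq_of_lt_right hlt
  rw [h0, map_zero] at h1
  exact hne h1.symm

/-- Leading monomials can be removed one at a time, so the monomials of weight at most `n` span the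
functions of pole order at most `n` that vanish at the branch points. -/
theorem mem_span_of_valuation_le (n : ℕ) : ∀ f ∈ C.RHat,
    v (algebraMap C.R C.K f) ^ 3 ≤ v C.xK ^ n →
      f ∈ Submodule.span ℂ (φ.fn '' {i | C.wt (φ.exponent i) ≤ n}) := by
  induction n using Nat.strong_induction_on with
  | _ n ih =>
    intro f hf hfn
    by_cases hf0 : f = 0
    · rw [hf0]
      exact zero_mem _
    obtain ⟨e, he, hfe⟩ := exists_valuation_eq_wt hx hf hf0
    obtain ⟨i, hi⟩ := φ.exhaustive e (by omega)
    have hin : C.wt (φ.exponent i) ≤ n := by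
      rw [hfe, pow_le_pow_iff_right₀ hx] at hfn
      omega
    have hval : v (algebraMap C.R C.K f) = v (algebraMap C.R C.K (φ.fn i)) := by
      rw [← v.pow_three_eq_iff, hfe, ← hi]
      exact (valuation_monomial hx _).symm
    obtain ⟨c, hc⟩ := exists_sub_lt hx hf0 hval
    have hmem : c • φ.fn i ∈ Submodule.span ℂ (φ.fn '' {i | C.wt (φ.exponent i) ≤ n}) :=
      Submodule.smul_mem _ _ (Submodule.subset_span ⟨i, hin, rfl⟩)
    have hsub : f - c • φ.fn i ∈ C.RHat :=
      sub_mem hf (Submodule.smul_mem _ _ (C.monomial_mem_RHat (φ.divisible i)))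
    rw [← sub_add_cancel f (c • φ.fn i)]
    refine add_mem ?_ hmem
    by_cases hg0 : f - c • φ.fn i = 0
    · rw [hg0]
      exact zero_mem _
    obtain ⟨e', he', hge⟩ := exists_valuation_eq_wt hx hsub hg0
    rw [← v.pow_three_lt_iff, hge, hfe, pow_lt_pow_iff_right₀ hx] at hc
    refine Submodule.span_mono (Set.image_mono ?_) (ih (C.wt e') (by omega) _ hsub hge.le)
    intro k hk
    simp only [Set.mem_ofPred_eq] at hk ⊢
    omega

theorem span_range_fn : Submodule.span ℂ (Set.range φ.fn) = C.RHat := by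
  refine le_antisymm (Submodule.span_le.2 ?_) fun f hf => ?_
  · rintro _ ⟨i, rfl⟩
    exact C.monomial_mem_RHat (φ.divisible i)
  · by_cases hf0 : f = 0
    · rw [hf0]
      exact zero_mem _
    obtain ⟨e, -, hfe⟩ := exists_valuation_eq_wt hx hf hf0
    exact Submodule.span_mono (Set.image_subset_range _ _)
      (mem_span_of_valuation_le hx φ _ f hf hfe.le)

end Weights

theorem formThird_eq (f : C.R) : C.formThird f = (3⁻¹ : ℂ) • C.form f := by
  have h : algebraMap ℂ C.K 3⁻¹ = (3 : C.K)⁻¹ := by rw [map_inv₀, map_ofNat]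
  rw [← algebraMap_smul C.K (3⁻¹ : ℂ), h, formThird, form, smul_smul]
  congr 1
  rw [mul_assoc 3, inv_mul_eq_div, div_div, mul_comm 3]

end TrigonalData

end

/-- There is exactly one point `∞` of `X` at which `x` has a pole, and for every sequence
`φ̂` the `φ̂ᵢ` form a basis of `R̂`, the `φ̂ᵢ dx / (y_r̂ y_ŝ)` form a basis of `H⁰(X ∖ ∞, Ω)`,
and the `φ̂ᵢ₋₁ dx / (3 y_r̂ y_ŝ)`, `1 ≤ i ≤ g`, form a basis of `H⁰(X, Ω)`. -/
theorem mainTheorem7 (C : TrigonalData) :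
    ∃ infty : CurvePoint ℂ C.K,
      (∀ P : CurvePoint ℂ C.K, algebraMap C.R C.K C.x ∉ P.ring ↔ P = infty) ∧
      ∀ φ : C.PhiHat,
        IsBasisOf φ.fn C.RHat ∧
        IsBasisOf (fun n : ℕ => C.form (φ.fn n))
          (regularDifferentialsOn ({infty}ᶜ : Set (CurvePoint ℂ C.K))) ∧
        IsBasisOf (fun i : Fin C.g => C.formThird (φ.fn i))
          (regularDifferentialsOn (Set.univ : Set (CurvePoint ℂ C.K))) := by
  obtain ⟨P, hP⟩ := C.exists_curvePoint_pole
  have hpole : ∀ Q : CurvePoint ℂ C.K, C.xK ∉ Q.ring ↔ Q = P :=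
    fun Q => ⟨fun hQ => TrigonalData.eq_of_pole hQ hP, fun h => h ▸ hP⟩
  refine ⟨P, hpole, fun φ => ?_⟩
  have hx := TrigonalData.one_lt_valuation hP
  have hli := TrigonalData.linearIndependent_fn hx φ
  have hspan := TrigonalData.span_range_fn hx φ
  have hker : LinearMap.ker C.formLinearMap = ⊥ := LinearMap.ker_eq_bot.2 C.formLinearMap_injective
  have haff : ∀ Q : CurvePoint ℂ C.K, Q ≠ P → ∀ f ∈ C.RHat, C.form f ∈ Q.regularDifferentials :=
    fun Q hQ f hf => C.form_mem_regularDifferentials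
      (TrigonalData.algebraMap_mem_ring (by_contra fun h => hQ ((hpole Q).1 h))) hf
  refine ⟨⟨hli, hspan⟩, ⟨hli.map' C.formLinearMap hker, ?_⟩, ?_, ?_⟩
  · have h : Set.range (fun n => C.form (φ.fn n)) = C.formLinearMap '' Set.range φ.fn :=
      Set.range_comp C.formLinearMap φ.fn
    rw [h, Submodule.span_image, hspan]
    ext ω
    rw [mem_regularDifferentialsOn]
    constructor
    · rintro ⟨f, hf, rfl⟩ Q hQ
      exact haff Q hQ f hf
    · intro hω
      obtain ⟨f, hf, rfl⟩ := C.exists_form_eq_of_regular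
        fun Q hQ => hω Q fun h => (hpole Q).2 h hQ
      exact ⟨f, hf, rfl⟩
  · have h : (fun i : Fin C.g => C.formThird (φ.fn i))
        = fun i : Fin C.g => (Units.mk0 (3⁻¹ : ℂ) (by norm_num)) • C.form (φ.fn i) :=
      funext fun i => C.formThird_eq _
    rw [h]
    exact ((hli.map' C.formLinearMap hker).comp _ Fin.val_injective).units_smul fun _ => _
  · apply le_antisymm
    · rw [Submodule.span_le]
      rintro _ ⟨i, rfl⟩
      rw [SetLike.mem_coe, mem_regularDifferentialsOn]
      intro Q _
      simp only [C.formThird_eq]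
      refine Submodule.smul_mem _ _ ?_
      by_cases hQ : Q = P
      · rw [hQ]
        exact TrigonalData.form_mem_of_valuation_le hP
          ((TrigonalData.wt_lt_iff hx φ i).2 i.2) (TrigonalData.valuation_monomial hx _)
      · exact haff Q hQ _ (C.monomial_mem_RHat (φ.divisible i))
    · intro ω hω
      rw [mem_regularDifferentialsOn] at hω
      obtain ⟨f, hf, rfl⟩ := C.exists_form_eq_of_regular fun Q _ => hω Q trivial
      have hle := TrigonalData.valuation_le_of_form_mem hP (hω P trivial)
      have hmem := TrigonalData.mem_span_of_valuation_le hx φ _ f hf hle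
      have himage := Submodule.mem_map_of_mem (f := C.formLinearMap) hmem
      rw [Submodule.map_span] at himage
      refine Submodule.span_le.2 ?_ himage
      rintro _ ⟨_, ⟨n, hn, rfl⟩, rfl⟩
      have hng : n < C.g := (TrigonalData.wt_lt_iff hx φ n).1
        (lt_of_le_of_ne hn (TrigonalData.wt_ne hx φ n))
      have h3 : C.form (φ.fn n) = (3 : ℂ) • C.formThird (φ.fn n) := by
        rw [C.formThird_eq, smul_smul, mul_inv_cancel₀ three_ne_zero, one_smul]
      change C.form (φ.fn n) ∈ _
      rw [h3]
      exact Submodule.smul_mem _ _ (Submodule.subset_span ⟨⟨n, hng⟩, rfl⟩)
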